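/- Theorem ($G_2(V)$ as $\Pi(E\oplus\dots\oplus E)$). Let $V=V_0\oplus V_1=\mathbb R^{n|m}$. Let $G_2(V)=\mathrm{St}_{2|0}(V)/GL(2)$ be the super Grassmannian of $2|0$-planes, where $\mathrm{St}_{2|0}(V)$ is the superdomain of pairs of independent even vectors, with even coordinates $u_i^a$ and odd coordinates $\xi_i^\mu$ ($i=1,2$; $a=1,\dots,n$; $\mu=1,\dots,m$); its underlying space is the ordinary Grassmannian $G_2(V_0)$. Let $E\to G_2(V_0)$ be the tautological bundle, and let $\Pi(E^{\oplus m})$ be the split supermanifold over $G_2(V_0)$ whose functions are the smooth sections of $\Lambda((E^{\oplus m})^*)$. For even variables $T^{ab}=-T^{ba}$, at least one of them invertible, and odd variables $\theta^{a\mu}$, consider the reduced relations $$\text{(ev)}\quad T^{ab}T^{cd}=T^{ac}T^{bd}+T^{ad}T^{cb},\qquad \text{(odd)}\quad T^{ab}\theta^{c\mu}=T^{ac}\theta^{b\mu}+T^{cb}\theta^{a\mu}$$ for all $a,b,c,d\in\{1,\dots,n\}$ and $\mu\in\{1,\dots,m\}$. Then: 1. For $T^{ab}$ and $\theta^{a\mu}$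 (even and odd, respectively) in any commutative real superalgebra $A=A_0\oplus A_1$, with $T$ antisymmetric and some $T^{ab}$ invertible, (ev) holds if and only if $T=u_1\wedge u_2$, i.e. $T^{ab}=\tfrac12(u_1^au_2^b-u_1^bu_2^a)$, for some $u_1,u_2\in A_0^n$. For any such $u_1,u_2$ and for each $\mu$, (odd) holds if and only if $\theta^{\cdot\mu}=\alpha_1u_1+\alpha_2u_2$ with $\alpha_1,\alpha_2\in A_1$; that is, (odd) says that the odd vector $\theta^{\cdot\mu}$ lies in the plane spanned by $u_1,u_2$. 2. In the projective superspace with homogeneous coordinates $(T^{ab}:\theta^{a\mu})$, the relations (ev), (odd) define $G_2(V)$: the super Plücker map $T^{ab}=\tfrac12(u_1^au_2^b-u_1^bu_2^a)$, $\theta^{a\mu}=\tfrac12(u_1^a\xi_2^\mu-u_2^a\xi_1^\mu)$ is a closed embedding of $G_2(V)$. Precisely, its underlying map is a closed embedding of topological spaces whose image is the set of points $(T)$ satisfying (ev); every function on $G_2(V)$ is locally the pullback of a function on the projective superspace; and the kernel of the pullback is the ideal sheaf generated by (ev), (odd). 3. There is an isomorphism of super vector bundles $G_2(V)\cong\Pi(\underbrace{E\oplus\dots\oplus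 E}_{m})$ over $G_2(V_0)$, i.e. an isomorphism of the structure sheaves of superalgebras over $G_2(V_0)$ that is the identity on functions on $G_2(V_0)$ and preserves the degree in the odd coordinates. It can be chosen so that the fibre point $(v_1,\dots,v_m)$, $v_\mu\in\Pi E$, corresponding to $(T:\theta)$ is $$v_\mu^b=\frac{\sum_aT^{ab}\theta^{a\mu}}{\sum_{c,d}(T^{cd})^2}\,.$$ -/

import Mathlib

open scoped ContDiff LinearAlgebra.Projectivization
open TopologicalSpace

namespace SuperGrassmann

section Relations

/-- Supercommutativity of a `ZMod 2`-graded algebra: `a * b = (-1)^(|a| |b|) b * a` for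
homogeneous `a`, `b`. -/
def IsSupercommutative {A : Type*} [Ring A] [Algebra ℝ A]
    (𝒜 : ZMod 2 → Submodule ℝ A) : Prop :=
  ∀ (i j : ZMod 2) (a b : A), a ∈ 𝒜 i → b ∈ 𝒜 j → a * b = (-1 : A) ^ (i.val * j.val) * (b * a)

variable {A : Type*} [Ring A] {n : ℕ}

/-- `T^{ab} T^{cd} - (T^{ac} T^{bd} + T^{ad} T^{cb})`. -/
def evenDefect (T : Fin n → Fin n → A) (a b c d : Fin n) : A :=
  T a b * T c d - (T a c * T b d + T a d * T c b)

/-- `T^{ab} θ^c - (T^{ac} θ^b + T^{cb} θ^a)`. -/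
def oddDefect (T : Fin n → Fin n → A) (θ : Fin n → A) (a b c : Fin n) : A :=
  T a b * θ c - (T a c * θ b + T c b * θ a)

/-- The even reduced relations (the classical Plücker relations). -/
def EvenRelations (T : Fin n → Fin n → A) : Prop :=
  ∀ a b c d, evenDefect T a b c d = 0

/-- The odd reduced relations for one value of the index `μ`, `θ = θ^{·μ}`. -/
def OddRelations (T : Fin n → Fin n → A) (θ : Fin n → A) : Prop :=
  ∀ a b c, oddDefect T θ a b c = 0

/-- `T = u₁ ∧ u₂`, that is, `T^{ab} = (u₁^a u₂^b - u₁^b u₂^a) / 2`. -/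
def IsWedge [Algebra ℝ A] (u : Fin 2 → Fin n → A) (T : Fin n → Fin n → A) : Prop :=
  ∀ a b, T a b = (1 / 2 : ℝ) • (u 0 a * u 1 b - u 0 b * u 1 a)

end Relations

section Superdomains

/-- For an open subset `N` of a normed space `X`, the superalgebra `C^∞(N) ⊗ Λ(M)` of functions on
the superdomain with underlying domain `N` and with `M` as its space of linear odd coordinates.
It is realized as the algebra of those maps `N → Λ(M)` that are polynomials in the odd coordinates
with smooth coefficients. -/
def superFun {X : Type*} [NormedAddCommGroup X] [NormedSpace ℝ X] (N : Set X)
    (M : Type*) [AddCommGroup M] [Module ℝ M] : Subalgebra ℝ (N → ExteriorAlgebra ℝ M) :=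
  Algebra.adjoin ℝ
    ({f | ∃ g : X → ℝ, ContDiffOn ℝ ∞ g N ∧ ∀ x : N, f x = algebraMap ℝ _ (g x)} ∪
      {f | ∃ v : M, ∀ x : N, f x = ExteriorAlgebra.ι ℝ v})

/-- The algebra homomorphism out of the exterior algebra on odd generators indexed by `I` that
substitutes the odd element `v i` for the `i`-th generator. -/
noncomputable def subst {I : Type*} [Fintype I] {M : Type*} [AddCommGroup M] [Module ℝ M]
    (v : I → M) : ExteriorAlgebra ℝ (I → ℝ) →ₐ[ℝ] ExteriorAlgebra ℝ M :=
  ExteriorAlgebra.map (Fintype.linearCombination ℝ v)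

end Superdomains

section OrdinaryGrassmannian

/-- Bases of 2-planes in `ℝ^n`: pairs of linearly independent vectors. -/
abbrev Frame (n : ℕ) := {x : Fin 2 → Fin n → ℝ // LinearIndependent ℝ x}

/-- The set of 2-planes in `V₀ = ℝ^n`. -/
def Gr (n : ℕ) := {L : Submodule ℝ (Fin n → ℝ) // Module.finrank ℝ L = 2}

/-- The plane spanned by a frame. -/
def planeOf {n : ℕ} (x : Frame n) : Gr n :=
  ⟨Submodule.span ℝ (Set.range x.1), by simpa using finrank_span_eq_card x.2⟩

/-- The Grassmannian carries the quotient topology from the space of frames. -/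
instance instTopologicalSpaceGr (n : ℕ) : TopologicalSpace (Gr n) :=
  TopologicalSpace.coinduced planeOf inferInstance

/-- The frames of the planes that belong to `W`, an open subset of the space of pairs of
vectors. -/
def framesOver {n : ℕ} (W : Opens (Gr n)) : Set (Fin 2 → Fin n → ℝ) :=
  {x | ∃ h : LinearIndependent ℝ x, planeOf ⟨x, h⟩ ∈ W}

/-- The plane of a frame over `W`, as a point of `W`. -/
def planeIn {n : ℕ} {W : Opens (Gr n)} (x : framesOver W) : W :=
  ⟨planeOf ⟨x.1, x.2.fst⟩, x.2.snd⟩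

end OrdinaryGrassmannian

section SuperGrassmannian

/-- The action of a 2 × 2 matrix on pairs of vectors. -/
noncomputable def rowAct {n : ℕ} (g : Matrix (Fin 2) (Fin 2) ℝ) (x : Fin 2 → Fin n → ℝ) :
    Fin 2 → Fin n → ℝ :=
  fun i => ∑ j, g i j • x j

/-- The odd homogeneous coordinate `ξ_i^μ`, as a basis vector of the space of linear odd
coordinates. -/
noncomputable def xi {m : ℕ} (i : Fin 2) (μ : Fin m) : Fin 2 × Fin m → ℝ := Pi.single (i, μ) 1

/-- The structure sheaf of the super Grassmannian `G_2(V) = St_{2|0}(V) / GL(2)`, `V = ℝ^{n|m}`,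
on the ordinary Grassmannian: functions `f(x, ξ)` on the part over `W` of the superdomain
`St_{2|0}(V)` of pairs of independent even vectors, with even coordinates `x_i^a` and odd
coordinates `ξ_i^μ`, that satisfy `f(g x, g ξ) = f(x, ξ)` for every `g` in `GL(2)`. -/
noncomputable def superGr (n m : ℕ) (W : Opens (Gr n)) :
    Subalgebra ℝ (framesOver W → ExteriorAlgebra ℝ (Fin 2 × Fin m → ℝ)) where
  carrier := {f | f ∈ superFun (framesOver W) (Fin 2 × Fin m → ℝ) ∧
    ∀ (g : GL (Fin 2) ℝ) (x y : framesOver W), y.1 = rowAct g.1 x.1 →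
      subst (fun p : Fin 2 × Fin m => ∑ j, g.1 p.1 j • xi j p.2) (f y) = f x}
  mul_mem' := fun {f h} hf hh => ⟨mul_mem hf.1 hh.1, fun g x y hxy => by
    rw [Pi.mul_apply, Pi.mul_apply, map_mul, hf.2 g x y hxy, hh.2 g x y hxy]⟩
  add_mem' := fun {f h} hf hh => ⟨add_mem hf.1 hh.1, fun g x y hxy => by
    rw [Pi.add_apply, Pi.add_apply, map_add, hf.2 g x y hxy, hh.2 g x y hxy]⟩
  algebraMap_mem' := fun r => ⟨Subalgebra.algebraMap_mem _ r, fun g x y _ => by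
    simp [Pi.algebraMap_apply]⟩

end SuperGrassmannian

section TautologicalBundle

/-- The fibre of `E ⊕ … ⊕ E` (`m` summands) at the plane `L`, `E` being the tautological
bundle. -/
abbrev Fibre {n : ℕ} (m : ℕ) (L : Gr n) : Type := Fin m → L.1

/-- The trivialization of the fibre of `E ⊕ … ⊕ E` at the span of `x` that comes from the
basis `x`. -/
noncomputable def frameMap {n m : ℕ} (x : Frame n) :
    (Fin m → Fin 2 → ℝ) →ₗ[ℝ] Fibre m (planeOf x) :=
  LinearMap.pi fun μ =>
    ((Fintype.linearCombination ℝ x.1).codRestrict (planeOf x).1 (fun c => by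
      rw [Fintype.linearCombination_apply]
      exact Submodule.sum_mem _ fun i _ =>
        Submodule.smul_mem _ _ (Submodule.subset_span ⟨i, rfl⟩))) ∘ₗ LinearMap.proj μ

/-- A family `L ↦ s(L) ∈ Λ((E_L ⊕ … ⊕ E_L)^*)` over `W`, expressed in frames. -/
noncomputable def inFrames {n m : ℕ} (W : Opens (Gr n)) :
    ((L : W) → ExteriorAlgebra ℝ (Module.Dual ℝ (Fibre m L.1))) →ₐ[ℝ]
      (framesOver W → ExteriorAlgebra ℝ (Module.Dual ℝ (Fin m → Fin 2 → ℝ))) :=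
  AlgHom.pi fun x =>
    (ExteriorAlgebra.map (frameMap (m := m) ⟨x.1, x.2.fst⟩).dualMap).comp
      (Pi.evalAlgHom ℝ _ (planeIn x))

/-- The structure sheaf of the split supermanifold `Π(E ⊕ … ⊕ E)`: smooth sections of the bundle
`Λ((E ⊕ … ⊕ E)^*)` of exterior algebras over the ordinary Grassmannian. -/
noncomputable def parityTaut (n m : ℕ) (W : Opens (Gr n)) :
    Subalgebra ℝ ((L : W) → ExteriorAlgebra ℝ (Module.Dual ℝ (Fibre m L.1))) :=
  (superFun (framesOver W) (Module.Dual ℝ (Fin m → Fin 2 → ℝ))).comap (inFrames W)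

/-- The odd fibre coordinate `v_μ^b` at `L`: the `b`-th coordinate of the `μ`-th vector of
`(v_1, …, v_m) ∈ L ⊕ … ⊕ L`. -/
noncomputable def fibreCoord {n m : ℕ} (L : Gr n) (b : Fin n) (μ : Fin m) :
    ExteriorAlgebra ℝ (Module.Dual ℝ (Fibre m L)) :=
  ExteriorAlgebra.ι ℝ (LinearMap.proj b ∘ₗ L.1.subtype ∘ₗ LinearMap.proj μ)

/-- An isomorphism of supermanifolds `G_2(V) → Π(E ⊕ … ⊕ E)` over the ordinary Grassmannian that
is an isomorphism of super vector bundles: on structure sheaves, isomorphisms of algebras that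
commute with restrictions, are the identity on the functions on the base, and preserve the degree
in the odd coordinates (hence the parity). -/
structure SuperBundleIso (n m : ℕ) where
  toEquiv : ∀ W : Opens (Gr n), parityTaut n m W ≃ₐ[ℝ] superGr n m W
  restrict : ∀ (W W' : Opens (Gr n)) (hW : W' ≤ W) (s : parityTaut n m W)
    (s' : parityTaut n m W'), (∀ L : W', s'.1 L = s.1 ⟨L.1, hW L.2⟩) →
    ∀ (x : framesOver W) (x' : framesOver W'), x.1 = x'.1 →
      (toEquiv W' s').1 x' = (toEquiv W s).1 x
  base : ∀ (W : Opens (Gr n)) (s : parityTaut n m W) (h : W → ℝ),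
    (∀ L : W, s.1 L = algebraMap ℝ _ (h L)) →
    ∀ x : framesOver W, (toEquiv W s).1 x = algebraMap ℝ _ (h (planeIn x))
  degree : ∀ (W : Opens (Gr n)) (s : parityTaut n m W) (k : ℕ),
    (∀ L : W, s.1 L ∈ ⋀[ℝ]^k (Module.Dual ℝ (Fibre m L.1))) ↔
      ∀ x : framesOver W, (toEquiv W s).1 x ∈ ⋀[ℝ]^k (Fin 2 × Fin m → ℝ)

end TautologicalBundle

section ProjectiveSuperspace

/-- The space `Λ²(ℝ^n)` of bivectors, as antisymmetric arrays `T^{ab}`. -/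
noncomputable def Bivector (n : ℕ) : Submodule ℝ (Fin n → Fin n → ℝ) where
  carrier := {T | ∀ a b, T a b = -T b a}
  add_mem' := fun {S T} hS hT a b => by
    rw [Pi.add_apply, Pi.add_apply, Pi.add_apply, Pi.add_apply, hS a b, hT a b]; ring
  zero_mem' := fun a b => by simp
  smul_mem' := fun c T hT a b => by
    rw [Pi.smul_apply, Pi.smul_apply, Pi.smul_apply, Pi.smul_apply, hT a b, smul_neg]

/-- The bivector `x₁ ∧ x₂`. -/
noncomputable def wedge {n : ℕ} (x : Fin 2 → Fin n → ℝ) : Bivector n :=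
  ⟨fun a b => (1 / 2 : ℝ) * (x 0 a * x 1 b - x 0 b * x 1 a), fun a b => by ring⟩

/-- The real projective space of lines in `Λ²(ℝ^n)`, with the quotient topology. -/
noncomputable instance instTopologicalSpaceProj (n : ℕ) : TopologicalSpace (ℙ ℝ (Bivector n)) :=
  TopologicalSpace.coinduced
    (fun T : {T : Bivector n // T ≠ 0} => Projectivization.mk ℝ T.1 T.2) inferInstance

/-- The nonzero bivectors that represent the points of `Ω`. -/
def coneOver {n : ℕ} (Ω : Opens (ℙ ℝ (Bivector n))) : Set (Bivector n) :=
  {T | ∃ h : T ≠ 0, Projectivization.mk ℝ T h ∈ Ω}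

/-- The structure sheaf of the projective superspace with even homogeneous coordinates `T^{ab}`,
at least one of them invertible, and odd homogeneous coordinates `θ^{aμ}`: functions `f(T, θ)`
with `f(c T, c θ) = f(T, θ)` for every `c ≠ 0`. -/
noncomputable def projFun (n m : ℕ) (Ω : Opens (ℙ ℝ (Bivector n))) :
    Subalgebra ℝ (coneOver Ω → ExteriorAlgebra ℝ (Fin n × Fin m → ℝ)) where
  carrier := {f | f ∈ superFun (coneOver Ω) (Fin n × Fin m → ℝ) ∧
    ∀ (c : ℝ) (S T : coneOver Ω), c ≠ 0 → S.1 = c • T.1 →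
      subst (fun p : Fin n × Fin m => c • (Pi.single p 1 : Fin n × Fin m → ℝ)) (f S) = f T}
  mul_mem' := fun {f h} hf hh => ⟨mul_mem hf.1 hh.1, fun c S T hc hST => by
    rw [Pi.mul_apply, Pi.mul_apply, map_mul, hf.2 c S T hc hST, hh.2 c S T hc hST]⟩
  add_mem' := fun {f h} hf hh => ⟨add_mem hf.1 hh.1, fun c S T hc hST => by
    rw [Pi.add_apply, Pi.add_apply, map_add, hf.2 c S T hc hST, hh.2 c S T hc hST]⟩
  algebraMap_mem' := fun r => ⟨Subalgebra.algebraMap_mem _ r, fun c S T _ _ => by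
    simp [Pi.algebraMap_apply]⟩

/-- The odd coordinate `θ^{aμ}`. -/
noncomputable def theta {n m : ℕ} (a : Fin n) (μ : Fin m) :
    ExteriorAlgebra ℝ (Fin n × Fin m → ℝ) :=
  ExteriorAlgebra.ι ℝ (Pi.single (a, μ) 1)

/-- The left-hand sides minus right-hand sides of the reduced relations, as functions on the
superdomain with coordinates `T ∈ N` and `θ^{aμ}`. -/
def reducedRelations (n m : ℕ) (N : Set (Bivector n)) :
    Set (superFun N (Fin n × Fin m → ℝ)) :=
  {r | (∃ a b c d, ∀ T : N, r.1 T =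
        evenDefect (fun p q => algebraMap ℝ (ExteriorAlgebra ℝ (Fin n × Fin m → ℝ)) (T.1.1 p q))
          a b c d) ∨
      ∃ (a b c : Fin n) (μ : Fin m), ∀ T : N, r.1 T =
        oddDefect (fun p q => algebraMap ℝ (ExteriorAlgebra ℝ (Fin n × Fin m → ℝ)) (T.1.1 p q))
          (fun p => theta p μ) a b c}

/-- `f` belongs to the ideal sheaf generated by the reduced relations: near each point it lies in
the ideal that they generate. -/
def InReducedIdeal {n m : ℕ} {Ω : Opens (ℙ ℝ (Bivector n))} (f : projFun n m Ω) : Prop :=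
  ∀ T : coneOver Ω, ∃ (N : Set (Bivector n)) (hN : N ⊆ coneOver Ω), IsOpen N ∧ T.1 ∈ N ∧
    ∃ r ∈ Ideal.span (reducedRelations n m N), ∀ S : N, f.1 ⟨S.1, hN S.2⟩ = r.1 S

/-- The super Plücker map on odd coordinates, at the frame `x`:
`θ^{aμ} ↦ (x₁^a ξ₂^μ - x₂^a ξ₁^μ) / 2`. -/
noncomputable def pluckerOdd {n m : ℕ} (x : Fin 2 → Fin n → ℝ) :
    ExteriorAlgebra ℝ (Fin n × Fin m → ℝ) →ₐ[ℝ] ExteriorAlgebra ℝ (Fin 2 × Fin m → ℝ) :=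
  subst fun p => (1 / 2 : ℝ) • (x 0 p.1 • xi 1 p.2 - x 1 p.1 • xi 0 p.2)

/-- `s` is the pullback of `f` under the super Plücker map `(x, ξ) ↦ (T : θ)` with
`T^{ab} = (x₁^a x₂^b - x₁^b x₂^a) / 2` and `θ^{aμ} = (x₁^a ξ₂^μ - x₂^a ξ₁^μ) / 2`, at all frames
where both are defined. -/
def IsPluckerPullback {n m : ℕ} {Ω : Opens (ℙ ℝ (Bivector n))} {W : Opens (Gr n)}
    (f : projFun n m Ω) (s : superGr n m W) : Prop :=
  ∀ (x : framesOver W) (T : coneOver Ω), T.1 = wedge x.1 → s.1 x = pluckerOdd x.1 (f.1 T)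

end ProjectiveSuperspace

end SuperGrassmann

open SuperGrassmann

/-! A decomposable bivector carries a frame of its plane in its own rows. If `T^{ab}` is invertible,
(ev) with a and b fixed says that `T^{ab} T^{cd}` is the minor of the rows a and b of T in the
columns c and d, so these rows, one of them rescaled, form a frame. Likewise (odd) with a and b
fixed expresses every `θ^c` through `θ^a` and `θ^b`. Even elements are central, so over a
superalgebra this is linear algebra over a commutative ring (`EvenRelations.isWedge`,
`oddRelations_iff_of_isWedge`).

The same rows invert the Plücker map. At the image of (x, ξ), the rows a and b of (T, θ) are g(x, ξ)
for a matrix g of determinant `T^{ab}/2`, so a GL(2)-invariant function evaluated on these rows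
extends the given one to a chart of the projective superspace (`exists_isPluckerPullback`). For the
kernel, the rescaled rows give a retraction ρ onto the solutions of the relations (`retract`,
`oddRetract`), and ρ factors through the Plücker map (`subst_oddRetract`). If f pulls back to zero,
then f = f - ρ*f, and such a difference lies in the ideal (`sub_pullback_mem_span`): T - ρ(T) and θ
- ρ(θ) are the relations divided by `T^{ab}`, Hadamard's lemma handles smooth coefficients, and a
Leibniz rule handles products. Near a point that violates (ev) some relation is a unit, so the ideal
is everything.

The bundle isomorphism comes from the Euclidean metric: `ξ_i^μ` corresponds to the linear form
`2⟨x_i, v_μ⟩`. Both sides transform alike under GL(2), so invariance of a function means that it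
depends on the plane only (`superGr_ext`); nondegeneracy of the Gram matrix makes the correspondence
invertible. The explicit formula for the fibre point is then Cramer's rule, with denominator given
by Lagrange's identity (`sum_wedge_sq`, `pairing_fibreCoord`). -/

namespace SuperGrassmann

/-! ### Hadamard's lemma and smooth extension from a ball. -/

section Hadamard

variable {X F : Type*} [NormedAddCommGroup X] [NormedSpace ℝ X] [FiniteDimensional ℝ X]
  [NormedAddCommGroup F] [NormedSpace ℝ F]

theorem hasFDerivAt_intervalIntegral_prod {H : X × ℝ → F} (hH : ContDiff ℝ 1 H) (x₀ : X) :
    HasFDerivAt (fun x => ∫ s in (0 : ℝ)..1, H (x, s))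
      (∫ s in (0 : ℝ)..1, (fderiv ℝ H (x₀, s)).comp (ContinuousLinearMap.inl ℝ X ℝ)) x₀ := by
  have hc : Continuous fun p : X × ℝ =>
      (fderiv ℝ H p).comp (ContinuousLinearMap.inl ℝ X ℝ) :=
    (hH.continuous_fderiv one_ne_zero).clm_comp continuous_const
  have : ProperSpace X := FiniteDimensional.proper ℝ X
  obtain ⟨C, hC⟩ := ((isCompact_closedBall x₀ 1).prod (isCompact_Icc (a := (0 : ℝ)) (b := 1)))
    |>.exists_bound_of_continuousOn hc.continuousOn
  refine intervalIntegral.hasFDerivAt_integral_of_dominated_of_fderiv_le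
    (F' := fun x s => (fderiv ℝ H (x, s)).comp (ContinuousLinearMap.inl ℝ X ℝ))
    (bound := fun _ => C)
    (Metric.closedBall_mem_nhds x₀ one_pos) ?_ ?_ ?_ ?_ ?_ ?_
  · exact Filter.Eventually.of_forall fun x =>
      (hH.continuous.comp (by fun_prop : Continuous fun s : ℝ => (x, s))).aestronglyMeasurable
  · exact (hH.continuous.comp
      (by fun_prop : Continuous fun s : ℝ => (x₀, s))).intervalIntegrable _ _
  · exact (hc.comp (by fun_prop : Continuous fun s : ℝ => (x₀, s))).aestronglyMeasurable
  · refine Filter.Eventually.of_forall fun s hs x hx => hC (x, s) ⟨hx, ?_⟩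
    rw [Set.uIoc_of_le zero_le_one] at hs
    exact ⟨hs.1.le, hs.2⟩
  · exact intervalIntegrable_const
  · refine Filter.Eventually.of_forall fun s _ x _ => ?_
    exact ((hH.differentiable one_ne_zero (x, s)).hasFDerivAt).comp x (hasFDerivAt_prodMk_left x s)

/-- Each directional derivative of the integral is again an integral of the same kind, with another
smooth integrand; hence induction on the order with `H` generalized. -/
theorem contDiff_intervalIntegral_prod {H : X × ℝ → F} (hH : ContDiff ℝ ∞ H) :
    ContDiff ℝ ∞ fun x => ∫ s in (0 : ℝ)..1, H (x, s) := by
  rw [contDiff_infty]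
  intro k
  induction k generalizing H with
  | zero =>
    rw [Nat.cast_zero, contDiff_zero]
    exact intervalIntegral.continuous_parametric_intervalIntegral_of_continuous'
      (f := fun x s => H (x, s)) hH.continuous 0 1
  | succ k ih =>
    have hd := hasFDerivAt_intervalIntegral_prod (hH.of_le (by simp : (1 : WithTop ℕ∞) ≤ ∞))
    rw [Nat.cast_succ, contDiff_succ_iff_fderiv_apply]
    refine ⟨fun x => (hd x).differentiableAt, by simp, fun y => ?_⟩
    have hH' := (contDiff_infty_iff_fderiv.1 hH).2
    have : (fun x => fderiv ℝ (fun x => ∫ s in (0 : ℝ)..1, H (x, s)) x y) =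
        fun x => ∫ s in (0 : ℝ)..1, (fun p => fderiv ℝ H p (y, 0)) (x, s) := by
      ext x
      rw [(hd x).fderiv, ContinuousLinearMap.intervalIntegral_apply]
      · rfl
      · refine Continuous.intervalIntegrable ?_ _ _
        exact (hH'.continuous.comp (by fun_prop : Continuous fun s : ℝ => (x, s))).clm_comp
          continuous_const
    rw [this]
    exact ih (hH'.clm_apply contDiff_const)

/-- Hadamard's lemma, with base and target point variable. -/
theorem exists_contDiff_sub_eq {g : X → ℝ} (hg : ContDiff ℝ ∞ g) :
    ∃ D : X × X → X →L[ℝ] ℝ, ContDiff ℝ ∞ D ∧ ∀ x y, g x - g y = D (x, y) (x - y) := by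
  have hg' := (contDiff_infty_iff_fderiv.1 hg).2
  -- The derivative of `g` along the segment from `y` to `x`; its average over the segment is the
  -- required coefficient.
  let H : (X × X) × ℝ → X →L[ℝ] ℝ := fun p => fderiv ℝ g (p.1.2 + p.2 • (p.1.1 - p.1.2))
  have hH : ContDiff ℝ ∞ H := hg'.comp (by fun_prop)
  refine ⟨_, contDiff_intervalIntegral_prod hH, fun x y => ?_⟩
  have hHc : Continuous fun s : ℝ => H ((x, y), s) := hH.continuous.comp (by fun_prop)
  rw [ContinuousLinearMap.intervalIntegral_apply (hHc.intervalIntegrable _ _)]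
  have hd : ∀ s ∈ Set.uIcc (0 : ℝ) 1,
      HasDerivAt (fun s : ℝ => g (y + s • (x - y))) (H ((x, y), s) (x - y)) s := by
    intro s _
    have h1 : HasDerivAt (fun s : ℝ => y + s • (x - y)) (x - y) s := by
      simpa using ((hasDerivAt_id s).smul_const (x - y)).const_add y
    exact ((hg.differentiable (by simp)) (y + s • (x - y))).hasFDerivAt.comp_hasDerivAt s h1
  rw [intervalIntegral.integral_eq_sub_of_hasDerivAt hd
    ((hHc.clm_apply continuous_const).intervalIntegrable _ _)]
  simp

/-- Hadamard's lemma above wants a function smooth on the whole space, while coefficients of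
superfunctions are smooth on an open set only. A bump function equal to 1 on the smaller ball
bridges the gap. -/
theorem exists_contDiff_eqOn_ball {U : Set X} {x₀ : X} {R : ℝ} (hU : IsOpen U) (hR : 0 < R)
    (hRU : Metric.closedBall x₀ R ⊆ U) {g : X → ℝ} (hg : ContDiffOn ℝ ∞ g U) :
    ∃ h : X → ℝ, ContDiff ℝ ∞ h ∧ Set.EqOn g h (Metric.ball x₀ (R / 2)) := by
  let χ : ContDiffBump x₀ := ⟨R / 2, R, by positivity, by linarith⟩
  refine ⟨fun x => χ x * g x, ?_, fun x hx => ?_⟩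
  · rw [contDiff_iff_contDiffAt]
    intro x
    by_cases hx : x ∈ U
    · exact χ.contDiff.contDiffAt.mul (hg.contDiffAt (hU.mem_nhds hx))
    · have hx' : x ∉ tsupport χ := by
        rw [χ.tsupport_eq]
        exact fun h => hx (hRU h)
      have h0 : (fun x => χ x * g x) =ᶠ[nhds x] fun _ => 0 := by
        filter_upwards [(isClosed_tsupport χ).isOpen_compl.mem_nhds hx'] with y hy
        rw [image_eq_zero_of_notMem_tsupport hy, zero_mul]
      exact contDiffAt_const.congr_of_eventuallyEq h0
  · simp only
    rw [χ.one_of_mem_closedBall (Metric.ball_subset_closedBall hx), one_mul]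

end Hadamard

/-! ### The reduced relations over a commutative superalgebra. -/

section Algebra

variable {n : ℕ}

theorem IsWedge.evenRelations {Z : Type*} [CommRing Z] [Algebra ℝ Z] {T : Fin n → Fin n → Z}
    {u : Fin 2 → Fin n → Z} (h : IsWedge u T) : EvenRelations T := by
  intro a b c d
  simp only [evenDefect, h _ _, Algebra.smul_def]
  ring

/-- The minors of the rows a and b are `T^{ab} T^{cd}`; the factor `2 s` on the second row cancels
both `T^{ab}` and the 1/2 in the wedge. -/
theorem EvenRelations.isWedge {Z : Type*} [CommRing Z] [Algebra ℝ Z] {T : Fin n → Fin n → Z}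
    (h : EvenRelations T) (hT : ∀ a b, T a b = -T b a) {a b : Fin n} {s : Z}
    (hs : T a b * s = 1) : IsWedge ![T a, fun c => (2 : ℝ) • (s * T b c)] T := by
  intro c d
  have h1 := h a b c d
  have h2 : (algebraMap ℝ Z (1 / 2)) * algebraMap ℝ Z 2 = 1 := by rw [← map_mul]; norm_num
  simp only [evenDefect, hT c b] at h1
  simp only [Matrix.cons_val_zero, Matrix.cons_val_one, Algebra.smul_def]
  linear_combination (-T c d) * hs + s * h1 + (s * T a d * T b c - s * T a c * T b d) * h2

theorem oddRelations_of_mem_span {Z M : Type*} [CommRing Z] [Algebra ℝ Z] [AddCommGroup M]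
    [Module Z M] {T : Fin n → Fin n → Z} {u : Fin 2 → Fin n → Z} (h : IsWedge u T) {θ : Fin n → M}
    {α β : M} (hθ : ∀ a, θ a = u 0 a • α + u 1 a • β) (a b c : Fin n) :
    T a b • θ c - (T a c • θ b + T c b • θ a) = 0 := by
  simp only [IsWedge, Algebra.smul_def] at h
  rw [hθ a, hθ b, hθ c, h a b, h a c, h c b]
  module

/-- One invertible minor suffices to solve for `θ^c`; substituting the wedge for T and regrouping
gives the coefficients, as in Cramer's rule. Values in a module allow odd θ, which do not lie in a
commutative ring of scalars. -/
theorem oddRelations_iff_of_isWedge {Z M : Type*} [CommRing Z] [Algebra ℝ Z] [AddCommGroup M]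
    [Module Z M] {T : Fin n → Fin n → Z} {u : Fin 2 → Fin n → Z} (h : IsWedge u T)
    {a₀ b₀ : Fin n} {s : Z} (hs : T a₀ b₀ * s = 1) (θ : Fin n → M) :
    (∀ a b c, T a b • θ c - (T a c • θ b + T c b • θ a) = 0) ↔
      ∀ c, θ c = u 0 c • ((algebraMap ℝ Z (1 / 2) * s) • (u 1 b₀ • θ a₀ - u 1 a₀ • θ b₀)) +
        u 1 c • ((algebraMap ℝ Z (1 / 2) * s) • (u 0 a₀ • θ b₀ - u 0 b₀ • θ a₀)) := by
  refine ⟨?_, fun H => oddRelations_of_mem_span h H⟩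
  simp only [IsWedge, Algebra.smul_def] at h
  intro H c
  have h1 : s • (T a₀ b₀ • θ c - (T a₀ c • θ b₀ + T c b₀ • θ a₀)) = 0 := by
    rw [H, smul_zero]
  have h2 : (T a₀ b₀ * s) • θ c = s • (T a₀ c • θ b₀ + T c b₀ • θ a₀) := by
    rw [← sub_eq_zero, ← h1]; module
  rw [hs, one_smul] at h2
  rw [h2, h a₀ c, h c b₀]
  module

theorem IsSupercommutative.mem_center {A : Type*} [Ring A] [Algebra ℝ A]
    {𝒜 : ZMod 2 → Submodule ℝ A} [GradedAlgebra 𝒜] (hA : IsSupercommutative 𝒜) {a : A}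
    (ha : a ∈ 𝒜 0) : a ∈ Subalgebra.center ℝ A := by
  rw [Subalgebra.mem_center_iff]
  intro b
  induction b using DirectSum.Decomposition.inductionOn 𝒜 with
  | zero => simp
  | @homogeneous j b => simpa using (hA 0 j a b ha b.2).symm
  | add x y hx hy => rw [add_mul, mul_add, hx, hy]

/-- Comparing degree 0 components in `a * b = 1` shows that the even part of `b` is already an
inverse. -/
theorem exists_mem_mul_eq_one {A : Type*} [Ring A] [Algebra ℝ A]
    {𝒜 : ZMod 2 → Submodule ℝ A} [GradedAlgebra 𝒜] {a : A} (ha : a ∈ 𝒜 0) (hu : IsUnit a) :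
    ∃ s ∈ 𝒜 0, a * s = 1 := by
  obtain ⟨b, hb⟩ := hu.exists_right_inv
  refine ⟨DirectSum.decompose 𝒜 b 0, SetLike.coe_mem _, ?_⟩
  rw [← DirectSum.coe_decompose_mul_add_of_left_mem 𝒜 ha, hb, add_zero,
    DirectSum.decompose_of_mem_same 𝒜 (SetLike.GradedOne.one_mem)]

theorem relations_iff {m : ℕ} {A : Type*} [Ring A] [Algebra ℝ A]
    (𝒜 : ZMod 2 → Submodule ℝ A) [GradedAlgebra 𝒜] (hA : IsSupercommutative 𝒜)
    (T : Fin n → Fin n → A) (hT0 : ∀ a b, T a b ∈ 𝒜 0) (hT : ∀ a b, T a b = -T b a)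
    (hunit : ∃ a b, IsUnit (T a b)) :
    (EvenRelations T ↔ ∃ u : Fin 2 → Fin n → A, (∀ i a, u i a ∈ 𝒜 0) ∧ IsWedge u T) ∧
      ∀ u : Fin 2 → Fin n → A, (∀ i a, u i a ∈ 𝒜 0) → IsWedge u T →
        ∀ θ : Fin m → Fin n → A, (∀ μ a, θ μ a ∈ 𝒜 1) →
          ∀ μ, OddRelations T (θ μ) ↔
            ∃ α : Fin 2 → A, (∀ i, α i ∈ 𝒜 1) ∧ ∀ a, θ μ a = α 0 * u 0 a + α 1 * u 1 a := by
  obtain ⟨a₀, b₀, hab⟩ := hunit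
  obtain ⟨s, hs0, hs⟩ := exists_mem_mul_eq_one (hT0 a₀ b₀) hab
  -- All even data live in the centre, so the commutative lemmas apply over `Z`, with `A` as a
  -- `Z`-module for the odd vectors.
  let Z := Subalgebra.center ℝ A
  let T' : Fin n → Fin n → Z := fun a b => ⟨T a b, hA.mem_center (hT0 a b)⟩
  let s' : Z := ⟨s, hA.mem_center hs0⟩
  have hs' : T' a₀ b₀ * s' = 1 := Subtype.ext hs
  have hT' : ∀ a b, T' a b = -T' b a := fun a b => Subtype.ext (hT a b)
  have h00 : ∀ {x y : A}, x ∈ 𝒜 0 → y ∈ 𝒜 0 → x * y ∈ 𝒜 0 := fun hx hy => by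
    simpa using SetLike.mul_mem_graded (A := 𝒜) hx hy
  have h01 : ∀ {x y : A}, x ∈ 𝒜 0 → y ∈ 𝒜 1 → x * y ∈ 𝒜 1 := fun hx hy => by
    simpa using SetLike.mul_mem_graded (A := 𝒜) hx hy
  have hev : EvenRelations T ↔ EvenRelations T' := by
    refine forall_congr' fun a => forall_congr' fun b => forall_congr' fun c =>
      forall_congr' fun d => ?_
    rw [← Subtype.coe_inj]
    rfl
  have hlift : ∀ (u : Fin 2 → Fin n → A) (hu : ∀ i a, u i a ∈ 𝒜 0), IsWedge u T →
      IsWedge (fun i a => (⟨u i a, hA.mem_center (hu i a)⟩ : Z)) T' := fun u hu h a b =>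
    Subtype.ext (h a b)
  refine ⟨⟨fun h => ?_, ?_⟩, fun u hu h θ hθ μ => ?_⟩
  · have hw := (hev.1 h).isWedge hT' hs'
    refine ⟨![T a₀, fun c => (2 : ℝ) • (s * T b₀ c)], ?_, fun a b => ?_⟩
    · rw [Fin.forall_fin_two]
      exact ⟨fun a => hT0 _ _, fun a => Submodule.smul_mem _ _ (h00 hs0 (hT0 _ _))⟩
    · exact congrArg Subtype.val (hw a b)
  · rintro ⟨u, hu, h⟩
    exact hev.2 (hlift u hu h).evenRelations
  · have hcomm : ∀ i a (x : A), u i a * x = x * u i a := fun i a x =>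
      (Subalgebra.mem_center_iff.1 (hA.mem_center (hu i a)) x).symm
    have key := oddRelations_iff_of_isWedge (hlift u hu h) hs' (θ μ)
    constructor
    · intro H
      refine ⟨![((1 / 2 : ℝ) • s) * (u 1 b₀ * θ μ a₀ - u 1 a₀ * θ μ b₀),
        ((1 / 2 : ℝ) • s) * (u 0 a₀ * θ μ b₀ - u 0 b₀ * θ μ a₀)], ?_, fun a => ?_⟩
      · rw [Fin.forall_fin_two]
        exact ⟨h01 (Submodule.smul_mem _ _ hs0)
            (Submodule.sub_mem _ (h01 (hu _ _) (hθ _ _)) (h01 (hu _ _) (hθ _ _))),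
          h01 (Submodule.smul_mem _ _ hs0)
            (Submodule.sub_mem _ (h01 (hu _ _) (hθ _ _)) (h01 (hu _ _) (hθ _ _)))⟩
      · have := key.1 H a
        rw [← Algebra.smul_def] at this
        simp only [Matrix.cons_val_zero, Matrix.cons_val_one, ← hcomm]
        exact this
    · rintro ⟨α, -, hα⟩ a b c
      exact oddRelations_of_mem_span (hlift u hu h) (α := α 0) (β := α 1)
        (fun a => by rw [hα a, ← hcomm, ← hcomm]; rfl) a b c

end Algebra

/-! ### Superfunctions and their pullbacks. -/

section SuperFunctions

set_option linter.unusedSectionVars false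

variable {X X' M M' : Type*} [NormedAddCommGroup X] [NormedSpace ℝ X] [NormedAddCommGroup X']
  [NormedSpace ℝ X'] [AddCommGroup M] [Module ℝ M] [AddCommGroup M'] [Module ℝ M']
  {N : Set X} {N' : Set X'}

theorem algebraMap_mem_superFun {g : X → ℝ} (hg : ContDiffOn ℝ ∞ g N) :
    (fun x : N => algebraMap ℝ (ExteriorAlgebra ℝ M) (g x)) ∈ superFun N M :=
  Algebra.subset_adjoin (Or.inl ⟨g, hg, fun _ => rfl⟩)

theorem ι_mem_superFun (v : M) :
    (fun _ : N => ExteriorAlgebra.ι ℝ v) ∈ superFun N M :=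
  Algebra.subset_adjoin (Or.inr ⟨v, fun _ => rfl⟩)

theorem smul_mem_superFun {g : X → ℝ} (hg : ContDiffOn ℝ ∞ g N)
    {f : N → ExteriorAlgebra ℝ M} (hf : f ∈ superFun N M) :
    (fun x : N => g x • f x) ∈ superFun N M := by
  have := mul_mem (algebraMap_mem_superFun (M := M) hg) hf
  simp only [Algebra.smul_def]
  exact this

theorem smul_ι_mem_superFun {g : X → ℝ} (hg : ContDiffOn ℝ ∞ g N) (v : M) :
    (fun x : N => ExteriorAlgebra.ι ℝ (g x • v)) ∈ superFun N M := by
  simpa only [map_smul] using smul_mem_superFun hg (ι_mem_superFun v)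

theorem ι_sum_mem_superFun {J : Type*} (s : Finset J) {v : J → N → M}
    (hv : ∀ j ∈ s, (fun x : N => ExteriorAlgebra.ι ℝ (v j x)) ∈ superFun N M) :
    (fun x : N => ExteriorAlgebra.ι ℝ (∑ j ∈ s, v j x)) ∈ superFun N M := by
  have := sum_mem hv
  convert this using 1
  ext x
  simp

theorem ι_add_mem_superFun {v w : N → M}
    (hv : (fun x : N => ExteriorAlgebra.ι ℝ (v x)) ∈ superFun N M)
    (hw : (fun x : N => ExteriorAlgebra.ι ℝ (w x)) ∈ superFun N M) :
    (fun x : N => ExteriorAlgebra.ι ℝ (v x + w x)) ∈ superFun N M := by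
  have := add_mem hv hw
  convert this using 1
  ext x
  simp

/-- The substitution `(x, ξ) ↦ (φ(x), v(x) ξ)`. -/
noncomputable def pullbackHom (φ : N' → N) (v : N' → M →ₗ[ℝ] M') :
    (N → ExteriorAlgebra ℝ M) →ₐ[ℝ] (N' → ExteriorAlgebra ℝ M') :=
  AlgHom.pi fun x => (ExteriorAlgebra.map (v x)).comp (Pi.evalAlgHom ℝ _ (φ x))

theorem pullbackHom_apply (φ : N' → N) (v : N' → M →ₗ[ℝ] M') (f : N → ExteriorAlgebra ℝ M)
    (x : N') : pullbackHom φ v f x = ExteriorAlgebra.map (v x) (f (φ x)) := rfl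

/-- Pullback is an algebra homomorphism, so only the two kinds of generators need checking. The
ambient map `ψ` is there because smoothness is stated for maps between the normed spaces. -/
theorem pullbackHom_mem_superFun {φ : N' → N} {v : N' → M →ₗ[ℝ] M'} {ψ : X' → X}
    (hψ : ContDiffOn ℝ ∞ ψ N') (hφ : ∀ x, (φ x : X) = ψ x)
    (hv : ∀ m, (fun x : N' => ExteriorAlgebra.ι ℝ (v x m)) ∈ superFun N' M')
    {f : N → ExteriorAlgebra ℝ M} (hf : f ∈ superFun N M) :
    pullbackHom φ v f ∈ superFun N' M' := by
  suffices superFun N M ≤ (superFun N' M').comap (pullbackHom φ v) from this hf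
  refine Algebra.adjoin_le ?_
  rintro f (⟨g, hg, h⟩ | ⟨m, h⟩)
  · have hm : Set.MapsTo ψ N' N := fun x hx => by
      rw [← hφ ⟨x, hx⟩]; exact (φ ⟨x, hx⟩).2
    have := algebraMap_mem_superFun (M := M') (hg.comp hψ hm)
    change pullbackHom φ v f ∈ superFun N' M'
    convert this using 1
    ext x
    rw [pullbackHom_apply, h, hφ, AlgHom.commutes, Function.comp_apply]
  · change pullbackHom φ v f ∈ superFun N' M'
    convert hv m using 1
    ext x
    rw [pullbackHom_apply, h, ExteriorAlgebra.map_apply_ι]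

theorem linearCombination_mem_superFun {I : Type*} [Fintype I] {w : N → I → M}
    (hw : ∀ i, (fun x : N => ExteriorAlgebra.ι ℝ (w x i)) ∈ superFun N M) (m : I → ℝ) :
    (fun x : N => ExteriorAlgebra.ι ℝ (Fintype.linearCombination ℝ (w x) m)) ∈ superFun N M := by
  simp only [Fintype.linearCombination_apply]
  refine ι_sum_mem_superFun _ fun i _ => ?_
  simpa only [map_smul] using smul_mem_superFun (g := fun _ => m i) contDiffOn_const (hw i)

theorem subst_ι {I : Type*} [Fintype I] [DecidableEq I] (v : I → M) (i : I) :
    subst v (ExteriorAlgebra.ι ℝ (Pi.single i 1)) = ExteriorAlgebra.ι ℝ (v i) := by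
  rw [subst, ExteriorAlgebra.map_apply_ι, Fintype.linearCombination_apply_single, one_smul]

theorem subst_subst {I J : Type*} [Fintype I] [Fintype J] (v : I → J → ℝ) (w : J → M)
    (x : ExteriorAlgebra ℝ (I → ℝ)) :
    subst w (subst v x) = subst (fun i => Fintype.linearCombination ℝ w (v i)) x := by
  simp only [subst]
  rw [← AlgHom.comp_apply, ExteriorAlgebra.map_comp_map]
  congr 1
  congr 1
  ext m
  simp [Fintype.linearCombination_apply]

end SuperFunctions

/-! ### Frames, planes and the action of GL(2). -/

section Planes

variable {n : ℕ}

theorem wedge_apply (x : Fin 2 → Fin n → ℝ) (a b : Fin n) :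
    (wedge x).1 a b = (1 / 2 : ℝ) * (x 0 a * x 1 b - x 0 b * x 1 a) := rfl

theorem linearIndependent_iff_wedge_ne_zero {x : Fin 2 → Fin n → ℝ} :
    LinearIndependent ℝ x ↔ wedge x ≠ 0 := by
  have hx : LinearIndependent ℝ x ↔ LinearIndependent ℝ ![x 0, x 1] := by
    rw [show ![x 0, x 1] = x from by ext i; fin_cases i <;> rfl]
  rw [hx, LinearIndependent.pair_iff]
  constructor
  · intro h h0
    have h1 : ∀ a b, x 0 a * x 1 b - x 0 b * x 1 a = 0 := fun a b => by
      have := congrFun (congrFun (congrArg Subtype.val h0) a) b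
      rw [wedge_apply] at this
      simpa using this
    have h2 : ∀ a, x 0 a = 0 := fun a => by
      have := h (-x 1 a) (x 0 a) (by
        ext b
        have := h1 a b
        simp only [Pi.add_apply, Pi.smul_apply, smul_eq_mul, Pi.zero_apply]
        linarith)
      exact this.2
    have := h 1 0 (by ext a; simp [h2])
    exact one_ne_zero this.1
  · intro h s t hst
    have hst' : ∀ a, s * x 0 a + t * x 1 a = 0 := fun a => by
      simpa using congrFun hst a
    obtain ⟨a, b, hab⟩ : ∃ a b, x 0 a * x 1 b - x 0 b * x 1 a ≠ 0 := by
      by_contra! hc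
      exact h (Subtype.ext (by ext a b; rw [wedge_apply, hc a b, mul_zero]; rfl))
    constructor
    · refine (mul_eq_zero.1 ?_).resolve_right hab
      linear_combination x 1 b * hst' a - x 1 a * hst' b
    · refine (mul_eq_zero.1 ?_).resolve_right hab
      linear_combination x 0 a * hst' b - x 0 b * hst' a

theorem rowAct_apply (g : Matrix (Fin 2) (Fin 2) ℝ) (x : Fin 2 → Fin n → ℝ) (i : Fin 2)
    (a : Fin n) : rowAct g x i a = g i 0 * x 0 a + g i 1 * x 1 a := by
  simp [rowAct, Fin.sum_univ_two]

theorem wedge_rowAct (g : Matrix (Fin 2) (Fin 2) ℝ) (x : Fin 2 → Fin n → ℝ) :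
    wedge (rowAct g x) = g.det • wedge x := by
  ext a b
  change (wedge (rowAct g x)).1 a b = g.det * (wedge x).1 a b
  simp only [wedge_apply, rowAct_apply, Matrix.det_fin_two]
  ring

theorem linearIndependent_rowAct (g : GL (Fin 2) ℝ) {x : Fin 2 → Fin n → ℝ}
    (hx : LinearIndependent ℝ x) : LinearIndependent ℝ (rowAct g.1 x) := by
  rw [linearIndependent_iff_wedge_ne_zero] at hx ⊢
  rw [wedge_rowAct]
  exact smul_ne_zero (Matrix.GeneralLinearGroup.det_ne_zero g) hx

theorem planeOf_rowAct (g : GL (Fin 2) ℝ) {x y : Frame n} (h : y.1 = rowAct g.1 x.1) :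
    planeOf y = planeOf x := by
  refine Subtype.ext (Submodule.eq_of_le_of_finrank_eq ?_ ?_)
  · refine Submodule.span_le.2 ?_
    rintro _ ⟨i, rfl⟩
    rw [h]
    exact Submodule.sum_mem _ fun j _ =>
      Submodule.smul_mem _ _ (Submodule.subset_span ⟨j, rfl⟩)
  · rw [(planeOf y).2, (planeOf x).2]

theorem exists_rowAct_of_planeOf_eq {x y : Frame n} (h : planeOf y = planeOf x) :
    ∃ g : GL (Fin 2) ℝ, y.1 = rowAct g.1 x.1 := by
  have hy : ∀ i, ∃ c : Fin 2 → ℝ, ∑ j, c j • x.1 j = y.1 i := fun i => by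
    rw [← Submodule.mem_span_range_iff_exists_fun]
    change y.1 i ∈ (planeOf x).1
    rw [← h]
    exact Submodule.subset_span ⟨i, rfl⟩
  choose g hg using hy
  have hg' : y.1 = rowAct (Matrix.of g) x.1 := funext fun i => (hg i).symm
  -- The bivector of `y` is the determinant times that of `x`, and it does not vanish.
  have hdet : (Matrix.of g).det ≠ 0 := fun h0 => by
    have := linearIndependent_iff_wedge_ne_zero.1 y.2
    rw [hg', wedge_rowAct, h0, zero_smul] at this
    exact this rfl
  exact ⟨Matrix.GeneralLinearGroup.mkOfDetNeZero _ hdet, hg'⟩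

theorem planeOf_surjective : Function.Surjective (planeOf (n := n)) := by
  intro L
  let b := Module.finBasisOfFinrankEq ℝ L.1 L.2
  have hb : LinearIndependent ℝ (fun i => (b i : Fin n → ℝ)) :=
    b.linearIndependent.map' L.1.subtype (Submodule.ker_subtype _)
  refine ⟨⟨_, hb⟩, Subtype.ext (Submodule.eq_of_le_of_finrank_eq ?_ ?_)⟩
  · refine Submodule.span_le.2 ?_
    rintro _ ⟨i, rfl⟩
    exact (b i).2
  · rw [(planeOf _).2, L.2]

theorem planeIn_surjective {W : Opens (Gr n)} : Function.Surjective (planeIn (W := W)) := by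
  rintro ⟨L, hL⟩
  obtain ⟨x, rfl⟩ := planeOf_surjective L
  exact ⟨⟨x.1, x.2, hL⟩, rfl⟩

theorem continuous_planeOf : Continuous (planeOf (n := n)) := continuous_coinduced_rng

theorem isOpen_framesOver (W : Opens (Gr n)) : IsOpen (framesOver W) := by
  have h1 : framesOver W = Subtype.val '' (planeOf (n := n) ⁻¹' W) := by
    ext x
    constructor
    · rintro ⟨h, hW⟩
      exact ⟨⟨x, h⟩, hW, rfl⟩
    · rintro ⟨y, hy, rfl⟩
      exact ⟨y.2, hy⟩
  rw [h1]
  exact (isOpen_setOfPred_linearIndependent (𝕜 := ℝ)).isOpenMap_subtype_val _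
    (W.2.preimage continuous_planeOf)

theorem rowAct_mem_framesOver (g : GL (Fin 2) ℝ) {W : Opens (Gr n)} {x : Fin 2 → Fin n → ℝ}
    (hx : x ∈ framesOver W) : rowAct g.1 x ∈ framesOver W := by
  obtain ⟨h, hW⟩ := hx
  refine ⟨linearIndependent_rowAct g h, ?_⟩
  rwa [planeOf_rowAct g (x := ⟨x, h⟩) rfl]

end Planes

/-! ### The Gram matrix and the pairing between odd coordinates and the fibre. -/

section Bundle

variable {n m : ℕ}

/-- The Gram matrix of a pair of vectors. -/
noncomputable def gram (x : Fin 2 → Fin n → ℝ) (i j : Fin 2) : ℝ := ∑ b, x i b * x j b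

noncomputable def gramDet (x : Fin 2 → Fin n → ℝ) : ℝ :=
  gram x 0 0 * gram x 1 1 - gram x 0 1 ^ 2

/-- The inverse of the Gram matrix. -/
noncomputable def gramInv (x : Fin 2 → Fin n → ℝ) : Fin 2 → Fin 2 → ℝ :=
  ![![(gramDet x)⁻¹ * gram x 1 1, -((gramDet x)⁻¹ * gram x 0 1)],
    ![-((gramDet x)⁻¹ * gram x 0 1), (gramDet x)⁻¹ * gram x 0 0]]

theorem gram_comm (x : Fin 2 → Fin n → ℝ) (i j : Fin 2) : gram x i j = gram x j i :=
  Finset.sum_congr rfl fun _ _ => mul_comm _ _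

/-- Lagrange's identity. It identifies the denominator of the fibre formula and, as a sum of
squares, shows that the Gram determinant of a frame is nonzero. -/
theorem sum_wedge_sq (x : Fin 2 → Fin n → ℝ) :
    ∑ c, ∑ d, (wedge x).1 c d ^ 2 = gramDet x / 2 := by
  have h : ∀ c d, (wedge x).1 c d ^ 2 = 1 / 4 * ((x 0 c * x 0 c) * (x 1 d * x 1 d)) +
      1 / 4 * ((x 1 c * x 1 c) * (x 0 d * x 0 d)) -
      1 / 2 * ((x 0 c * x 1 c) * (x 0 d * x 1 d)) := fun c d => by
    rw [wedge_apply]; ring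
  simp only [h, Finset.sum_sub_distrib, Finset.sum_add_distrib, ← Finset.mul_sum,
    ← Finset.sum_mul, gramDet, gram]
  ring

theorem gramDet_ne_zero {x : Fin 2 → Fin n → ℝ} (hx : LinearIndependent ℝ x) :
    gramDet x ≠ 0 := by
  intro h
  refine linearIndependent_iff_wedge_ne_zero.1 hx (Subtype.ext ?_)
  have h0 := sum_wedge_sq x
  rw [h, zero_div, Finset.sum_eq_zero_iff_of_nonneg
    fun c _ => Finset.sum_nonneg fun d _ => sq_nonneg _] at h0
  ext c d
  have h1 := h0 c (Finset.mem_univ _)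
  rw [Finset.sum_eq_zero_iff_of_nonneg fun d _ => sq_nonneg _] at h1
  exact pow_eq_zero_iff two_ne_zero |>.1 (h1 d (Finset.mem_univ _))

theorem contDiff_gram (i j : Fin 2) :
    ContDiff ℝ ∞ fun x : Fin 2 → Fin n → ℝ => gram x i j := by
  unfold gram
  fun_prop

theorem contDiffOn_gramInv {N : Set (Fin 2 → Fin n → ℝ)} (hN : ∀ x ∈ N, LinearIndependent ℝ x)
    (i j : Fin 2) : ContDiffOn ℝ ∞ (fun x => gramInv x i j) N := by
  have hd : ContDiffOn ℝ ∞ (fun x : Fin 2 → Fin n → ℝ => (gramDet x)⁻¹) N := by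
    refine ContDiffOn.inv (ContDiff.contDiffOn ?_) fun x hx => gramDet_ne_zero (hN x hx)
    exact ((contDiff_gram 0 0).mul (contDiff_gram 1 1)).sub ((contDiff_gram 0 1).pow 2)
  have h := fun i j => hd.mul (contDiff_gram (n := n) i j).contDiffOn
  fin_cases i <;> fin_cases j
  exacts [h 1 1, (h 0 1).neg, (h 0 1).neg, h 0 0]

theorem gram_mul_gramInv {x : Fin 2 → Fin n → ℝ} (hx : LinearIndependent ℝ x) (i k : Fin 2) :
    ∑ j, gram x i j * gramInv x j k = if i = k then 1 else 0 := by
  have hd := gramDet_ne_zero hx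
  have hd' : gram x 0 0 * gram x 1 1 - gram x 0 1 ^ 2 ≠ 0 := hd
  have h10 := gram_comm x 1 0
  fin_cases i <;> fin_cases k <;>
    simp [gramInv, Fin.sum_univ_two, gramDet, h10] <;> field_simp <;> ring

theorem gramInv_mul_gram {x : Fin 2 → Fin n → ℝ} (hx : LinearIndependent ℝ x) (i k : Fin 2) :
    ∑ j, gramInv x i j * gram x j k = if i = k then 1 else 0 := by
  have hd := gramDet_ne_zero hx
  have hd' : gram x 0 0 * gram x 1 1 - gram x 0 1 ^ 2 ≠ 0 := hd
  have h10 := gram_comm x 1 0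
  fin_cases i <;> fin_cases k <;>
    simp [gramInv, Fin.sum_univ_two, gramDet, h10] <;> field_simp <;> ring

/-- The linear odd coordinate `(i, μ)` as the linear form `v ↦ 2 ⟨x_i, v_μ⟩` on the fibre. -/
noncomputable def pairing (L : Gr n) (x : Fin 2 → Fin n → ℝ) :
    (Fin 2 × Fin m → ℝ) →ₗ[ℝ] Module.Dual ℝ (Fibre m L) :=
  Fintype.linearCombination ℝ fun p : Fin 2 × Fin m =>
    (2 : ℝ) • ∑ b, x p.1 b • (LinearMap.proj b ∘ₗ L.1.subtype ∘ₗ LinearMap.proj p.2)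

theorem pairing_xi (L : Gr n) (x : Fin 2 → Fin n → ℝ) (i : Fin 2) (μ : Fin m) (v : Fibre m L) :
    pairing L x (xi i μ) v = 2 * ∑ b, x i b * (v μ).1 b := by
  rw [pairing, xi, Fintype.linearCombination_apply_single]
  simp [LinearMap.sum_apply]

/-- The forms `⟨x_i, v_μ⟩` change under g exactly as the `ξ_i^μ` do; this equivariance is what turns
invariant functions into functions on the fibre. -/
theorem pairing_rowAct (L : Gr n) (g : Matrix (Fin 2) (Fin 2) ℝ) (x : Fin 2 → Fin n → ℝ) :
    pairing (m := m) L (rowAct g x) = pairing L x ∘ₗ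
      Fintype.linearCombination ℝ fun p : Fin 2 × Fin m => ∑ j, g p.1 j • xi j p.2 := by
  refine LinearMap.pi_ext' fun p => LinearMap.ext_ring ?_
  refine LinearMap.ext fun v => ?_
  obtain ⟨i, μ⟩ := p
  change pairing L (rowAct g x) (xi i μ) v = pairing L x (Fintype.linearCombination ℝ _ (xi i μ)) v
  rw [pairing_xi, xi, Fintype.linearCombination_apply_single]
  simp only [one_smul, map_smul, Fin.sum_univ_two, LinearMap.add_apply,
    LinearMap.smul_apply, smul_eq_mul, map_add, pairing_xi, rowAct_apply, add_mul,
    Finset.mul_sum, ← Finset.sum_add_distrib]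
  exact Finset.sum_congr rfl fun _ _ => by ring

/-- The `j`-th coordinate of the `μ`-th vector, as a linear form. -/
def coordForm (j : Fin 2) (μ : Fin m) : Module.Dual ℝ (Fin m → Fin 2 → ℝ) :=
  LinearMap.proj (φ := fun _ : Fin 2 => ℝ) j ∘ₗ LinearMap.proj (φ := fun _ : Fin m => Fin 2 → ℝ) μ

theorem coordForm_apply (j : Fin 2) (μ : Fin m) (c : Fin m → Fin 2 → ℝ) :
    coordForm j μ c = c μ j := rfl

/-- `pairing` in the trivialization of the fibre given by the frame `x`. -/
noncomputable def framePairing (x : Fin 2 → Fin n → ℝ) :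
    (Fin 2 × Fin m → ℝ) →ₗ[ℝ] Module.Dual ℝ (Fin m → Fin 2 → ℝ) :=
  Fintype.linearCombination ℝ fun p : Fin 2 × Fin m =>
    ∑ j, (2 * gram x p.1 j) • coordForm j p.2

/-- The inverse of `framePairing`. -/
noncomputable def frameUnpairing (x : Fin 2 → Fin n → ℝ) :
    Module.Dual ℝ (Fin m → Fin 2 → ℝ) →ₗ[ℝ] (Fin 2 × Fin m → ℝ) :=
  ∑ μ, ∑ j, (LinearMap.toSpanSingleton ℝ _ (∑ i, (1 / 2 * gramInv x j i) • xi i μ)) ∘ₗ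
    LinearMap.applyₗ (Pi.single μ (Pi.single j 1))

theorem framePairing_xi (x : Fin 2 → Fin n → ℝ) (i : Fin 2) (μ : Fin m) :
    framePairing x (xi i μ) =
      ∑ j, (2 * gram x i j) • coordForm j μ := by
  rw [framePairing, xi, Fintype.linearCombination_apply_single, one_smul]

theorem frameUnpairing_apply (x : Fin 2 → Fin n → ℝ) (l : Module.Dual ℝ (Fin m → Fin 2 → ℝ)) :
    frameUnpairing x l = ∑ μ, ∑ j, l (Pi.single μ (Pi.single j 1)) •
      ∑ i, (1 / 2 * gramInv x j i) • xi i μ := by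
  simp [frameUnpairing, LinearMap.sum_apply]

theorem frameUnpairing_proj (x : Fin 2 → Fin n → ℝ) (j : Fin 2) (μ : Fin m) :
    frameUnpairing x (coordForm j μ) =
      ∑ i, (1 / 2 * gramInv x j i) • xi i μ := by
  rw [frameUnpairing_apply, Finset.sum_eq_single μ, Finset.sum_eq_single j]
  · simp [coordForm_apply]
  · intro k _ hk
    simp [coordForm_apply, Pi.single_eq_of_ne hk.symm]
  · simp
  · intro ν _ hν
    refine Finset.sum_eq_zero fun k _ => ?_
    simp [coordForm_apply, Pi.single_eq_of_ne hν.symm]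
  · simp

theorem frameUnpairing_framePairing {x : Fin 2 → Fin n → ℝ} (hx : LinearIndependent ℝ x) :
    frameUnpairing x ∘ₗ framePairing (m := m) x = LinearMap.id := by
  refine LinearMap.pi_ext' fun p => LinearMap.ext_ring ?_
  obtain ⟨i, μ⟩ := p
  change frameUnpairing x (framePairing x (xi i μ)) = xi i μ
  rw [framePairing_xi, map_sum]
  simp only [map_smul, frameUnpairing_proj, Finset.smul_sum, smul_smul]
  rw [Finset.sum_comm]
  simp only [← Finset.sum_smul]
  have h : ∀ k, ∑ j, 2 * gram x i j * (1 / 2 * gramInv x j k) = if i = k then 1 else 0 :=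
    fun k => by
      rw [← gram_mul_gramInv hx]
      exact Finset.sum_congr rfl fun j _ => by ring
  simp only [h, ite_smul, one_smul, zero_smul, Finset.sum_ite_eq, Finset.mem_univ, if_true]

theorem framePairing_frameUnpairing {x : Fin 2 → Fin n → ℝ} (hx : LinearIndependent ℝ x) :
    framePairing (m := m) x ∘ₗ frameUnpairing x = LinearMap.id := by
  refine LinearMap.ext fun l => LinearMap.ext fun c => ?_
  have h : ∀ j k, ∑ i, 1 / 2 * gramInv x j i * (2 * gram x i k) = if j = k then 1 else 0 :=
    fun j k => by
      rw [← gramInv_mul_gram hx]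
      exact Finset.sum_congr rfl fun j _ => by ring
  have h' : ∀ j (μ : Fin m), framePairing x (∑ i, (1 / 2 * gramInv x j i) • xi i μ) =
      coordForm j μ := fun j μ => by
    rw [map_sum]
    simp only [map_smul, framePairing_xi, Finset.smul_sum, smul_smul]
    rw [Finset.sum_comm]
    simp only [← Finset.sum_smul, h, ite_smul, one_smul, zero_smul, Finset.sum_ite_eq,
      Finset.mem_univ, if_true]
  rw [LinearMap.comp_apply, frameUnpairing_apply]
  simp only [map_sum, map_smul, h', LinearMap.sum_apply, LinearMap.smul_apply, coordForm_apply,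
    LinearMap.id_apply, smul_eq_mul]
  have hc : c = ∑ μ, ∑ j, c μ j • (Pi.single μ (Pi.single j 1) : Fin m → Fin 2 → ℝ) := by
    ext ν k
    rw [Finset.sum_apply, Finset.sum_eq_single ν]
    · fin_cases k <;> simp
    · intro μ _ hμ
      simp [Pi.single_eq_of_ne hμ.symm]
    · simp
  conv_rhs => rw [hc]
  simp only [map_sum, map_smul, smul_eq_mul, mul_comm]

theorem framePairing_mem_superFun {N : Set (Fin 2 → Fin n → ℝ)} (v : Fin 2 × Fin m → ℝ) :
    (fun x : N => ExteriorAlgebra.ι ℝ (framePairing (m := m) x.1 v)) ∈ superFun N _ :=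
  linearCombination_mem_superFun (fun p => ι_sum_mem_superFun _ fun j _ =>
    smul_ι_mem_superFun (contDiff_const.mul (contDiff_gram p.1 j)).contDiffOn _) v

theorem frameUnpairing_mem_superFun {N : Set (Fin 2 → Fin n → ℝ)}
    (hN : ∀ x ∈ N, LinearIndependent ℝ x) (l : Module.Dual ℝ (Fin m → Fin 2 → ℝ)) :
    (fun x : N => ExteriorAlgebra.ι ℝ (frameUnpairing x.1 l)) ∈ superFun N _ := by
  simp only [frameUnpairing_apply, Finset.smul_sum, smul_smul]
  exact ι_sum_mem_superFun _ fun μ _ => ι_sum_mem_superFun _ fun j _ =>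
    ι_sum_mem_superFun _ fun i _ => smul_ι_mem_superFun
      (g := fun x => l (Pi.single μ (Pi.single j 1)) * (1 / 2 * gramInv x j i))
      (contDiffOn_const.mul (contDiffOn_const.mul (contDiffOn_gramInv hN j i))) _

theorem frameMap_apply (x : Frame n) (c : Fin m → Fin 2 → ℝ) (μ : Fin m) (b : Fin n) :
    (frameMap x c μ).1 b = c μ 0 * x.1 0 b + c μ 1 * x.1 1 b := by
  change Fintype.linearCombination ℝ x.1 (c μ) b = _
  simp [Fintype.linearCombination_apply, Fin.sum_univ_two]

theorem frameMap_surjective (x : Frame n) : Function.Surjective (frameMap (m := m) x) := by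
  intro v
  have h : ∀ μ, ∃ c : Fin 2 → ℝ, ∑ j, c j • x.1 j = (v μ).1 := fun μ =>
    (Submodule.mem_span_range_iff_exists_fun ℝ).1 (v μ).2
  choose c hc using h
  refine ⟨c, funext fun μ => Subtype.ext ?_⟩
  rw [← hc μ]
  ext b
  rw [frameMap_apply]
  simp [Fin.sum_univ_two]

/-- In the trivialization by the frame itself the pairing is twice the Gram matrix, which varies
smoothly with the frame; both smoothness and invertibility are read off from this. -/
theorem dualMap_frameMap_pairing (x : Frame n) :
    (frameMap (m := m) x).dualMap ∘ₗ pairing (planeOf x) x.1 = framePairing x.1 := by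
  refine LinearMap.pi_ext' fun p => LinearMap.ext_ring ?_
  obtain ⟨i, μ⟩ := p
  change (frameMap (m := m) x).dualMap (pairing (planeOf x) x.1 (xi i μ)) =
    framePairing x.1 (xi i μ)
  refine LinearMap.ext fun c => ?_
  rw [LinearMap.dualMap_apply, pairing_xi, framePairing_xi]
  simp only [frameMap_apply, Fin.sum_univ_two, LinearMap.add_apply, LinearMap.smul_apply,
    coordForm_apply, gram, smul_eq_mul, Finset.mul_sum, Finset.sum_mul]
  rw [← Finset.sum_add_distrib]
  exact Finset.sum_congr rfl fun _ _ => by ring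

/-- The inverse of `pairing` for a frame. -/
noncomputable def unpairing (x : Frame n) :
    Module.Dual ℝ (Fibre m (planeOf x)) →ₗ[ℝ] (Fin 2 × Fin m → ℝ) :=
  frameUnpairing x.1 ∘ₗ (frameMap x).dualMap

theorem unpairing_pairing (x : Frame n) :
    unpairing x ∘ₗ pairing (m := m) (planeOf x) x.1 = LinearMap.id := by
  rw [unpairing, LinearMap.comp_assoc, dualMap_frameMap_pairing, frameUnpairing_framePairing x.2]

theorem pairing_unpairing (x : Frame n) :
    pairing (m := m) (planeOf x) x.1 ∘ₗ unpairing x = LinearMap.id := by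
  have hinj : Function.Injective (frameMap (m := m) x).dualMap :=
    LinearMap.dualMap_injective_of_surjective (frameMap_surjective x)
  refine LinearMap.ext fun l => hinj ?_
  rw [unpairing, ← LinearMap.comp_apply, ← LinearMap.comp_assoc, ← LinearMap.comp_assoc,
    dualMap_frameMap_pairing, framePairing_frameUnpairing x.2]
  rfl

theorem map_unpairing_map_pairing (x : Frame n) (y : ExteriorAlgebra ℝ (Fin 2 × Fin m → ℝ)) :
    ExteriorAlgebra.map (unpairing x) (ExteriorAlgebra.map (pairing (planeOf x) x.1) y) = y := by
  rw [← AlgHom.comp_apply, ExteriorAlgebra.map_comp_map, unpairing_pairing,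
    ExteriorAlgebra.map_id, AlgHom.id_apply]

theorem map_pairing_map_unpairing (x : Frame n)
    (y : ExteriorAlgebra ℝ (Module.Dual ℝ (Fibre m (planeOf x)))) :
    ExteriorAlgebra.map (pairing (planeOf x) x.1) (ExteriorAlgebra.map (unpairing x) y) = y := by
  rw [← AlgHom.comp_apply, ExteriorAlgebra.map_comp_map, pairing_unpairing,
    ExteriorAlgebra.map_id, AlgHom.id_apply]

theorem map_pairing_rowAct (L : Gr n) (g : Matrix (Fin 2) (Fin 2) ℝ) (x : Fin 2 → Fin n → ℝ)
    (y : ExteriorAlgebra ℝ (Fin 2 × Fin m → ℝ)) :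
    ExteriorAlgebra.map (pairing L (rowAct g x)) y = ExteriorAlgebra.map (pairing L x)
      (subst (fun p : Fin 2 × Fin m => ∑ j, g p.1 j • xi j p.2) y) := by
  rw [pairing_rowAct, ← ExteriorAlgebra.map_comp_map, AlgHom.comp_apply, subst]

theorem map_mem_exteriorPower {M M' : Type*} [AddCommGroup M] [Module ℝ M] [AddCommGroup M']
    [Module ℝ M'] (f : M →ₗ[ℝ] M') {k : ℕ} {y : ExteriorAlgebra ℝ M} (hy : y ∈ ⋀[ℝ]^k M) :
    ExteriorAlgebra.map f y ∈ ⋀[ℝ]^k M' := by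
  have h : Submodule.map (ExteriorAlgebra.map f).toLinearMap (⋀[ℝ]^k M) ≤ ⋀[ℝ]^k M' := by
    rw [Submodule.map_pow]
    refine pow_le_pow_left' ?_ k
    rintro _ ⟨_, ⟨v, rfl⟩, rfl⟩
    exact ⟨f v, (ExteriorAlgebra.map_apply_ι f v).symm⟩
  exact h ⟨y, hy, rfl⟩

end Bundle

/-! ### The isomorphism of structure sheaves and the fibre coordinates. -/

section Iso

variable {n m : ℕ}

/-- Two frames of a plane differ by g in GL(2), and the equivariance of the pairing absorbs g. Hence
the arbitrary choice in `someFrame` is harmless. -/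
theorem superGr_ext {W : Opens (Gr n)} {f : framesOver W → ExteriorAlgebra ℝ (Fin 2 × Fin m → ℝ)}
    (hf : f ∈ superGr n m W) {x y : framesOver W} (h : planeIn x = planeIn y) :
    ExteriorAlgebra.map (pairing (planeIn x).1 x.1) (f x) =
      ExteriorAlgebra.map (pairing (planeIn x).1 y.1) (f y) := by
  obtain ⟨g, hg⟩ := exists_rowAct_of_planeOf_eq (x := ⟨x.1, x.2.fst⟩) (y := ⟨y.1, y.2.fst⟩)
    (congrArg Subtype.val h).symm
  rw [← hf.2 g x y hg, hg, map_pairing_rowAct]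

/-- The frame of a plane used to write a function in the fibre coordinates. -/
noncomputable def someFrame {W : Opens (Gr n)} (L : W) : framesOver W :=
  (planeIn_surjective L).choose

theorem planeIn_someFrame {W : Opens (Gr n)} (L : W) : planeIn (someFrame L) = L :=
  (planeIn_surjective L).choose_spec

/-- A section of `Λ((E ⊕ … ⊕ E)^*)` written in the coordinates `(x, ξ)`. -/
noncomputable def sectionToFrames (W : Opens (Gr n)) :
    ((L : W) → ExteriorAlgebra ℝ (Module.Dual ℝ (Fibre m L.1))) →ₐ[ℝ]
      (framesOver W → ExteriorAlgebra ℝ (Fin 2 × Fin m → ℝ)) :=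
  AlgHom.pi fun x => (ExteriorAlgebra.map (unpairing ⟨x.1, x.2.fst⟩)).comp
    (Pi.evalAlgHom ℝ _ (planeIn x))

theorem sectionToFrames_apply (W : Opens (Gr n))
    (s : (L : W) → ExteriorAlgebra ℝ (Module.Dual ℝ (Fibre m L.1))) (x : framesOver W) :
    sectionToFrames W s x = ExteriorAlgebra.map (unpairing ⟨x.1, x.2.fst⟩) (s (planeIn x)) := rfl

theorem sectionToFrames_eq_pullbackHom (W : Opens (Gr n))
    (s : (L : W) → ExteriorAlgebra ℝ (Module.Dual ℝ (Fibre m L.1))) :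
    sectionToFrames W s = pullbackHom id (fun x => frameUnpairing x.1) (inFrames W s) := by
  ext x
  rw [sectionToFrames_apply, unpairing, ← ExteriorAlgebra.map_comp_map]
  rfl

theorem sectionToFrames_spec {W : Opens (Gr n)}
    (s : (L : W) → ExteriorAlgebra ℝ (Module.Dual ℝ (Fibre m L.1))) (x : framesOver W) (L : W)
    (h : planeIn x = L) :
    ExteriorAlgebra.map (pairing L.1 x.1) (sectionToFrames W s x) = s L := by
  subst h
  exact map_pairing_map_unpairing ⟨x.1, x.2.fst⟩ _

theorem planeIn_eq_of_rowAct {W : Opens (Gr n)} {g : GL (Fin 2) ℝ} {x y : framesOver W}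
    (h : y.1 = rowAct g.1 x.1) : planeIn y = planeIn x :=
  Subtype.ext (planeOf_rowAct g (x := ⟨x.1, x.2.fst⟩) (y := ⟨y.1, y.2.fst⟩) h)

theorem sectionToFrames_mem {W : Opens (Gr n)}
    {s : (L : W) → ExteriorAlgebra ℝ (Module.Dual ℝ (Fibre m L.1))} (hs : s ∈ parityTaut n m W) :
    sectionToFrames W s ∈ superGr n m W := by
  refine ⟨?_, fun g x y hxy => ?_⟩
  · rw [sectionToFrames_eq_pullbackHom]
    exact pullbackHom_mem_superFun (ψ := id) contDiff_id.contDiffOn (fun _ => rfl)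
      (frameUnpairing_mem_superFun fun _ hx => hx.fst) hs
  -- The pairing is injective, so invariance can be tested on the fibre, where both sides become the
  -- value of `s` at the common plane.
  · refine Function.LeftInverse.injective (map_unpairing_map_pairing ⟨x.1, x.2.fst⟩) ?_
    rw [← map_pairing_rowAct, ← hxy]
    exact (sectionToFrames_spec s y (planeIn x) (planeIn_eq_of_rowAct hxy)).trans
      (sectionToFrames_spec s x (planeIn x) rfl).symm

theorem sectionToFrames_injective (W : Opens (Gr n)) :
    Function.Injective (sectionToFrames (m := m) W) := by
  intro s t h
  ext L
  obtain ⟨x, rfl⟩ := planeIn_surjective L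
  rw [← sectionToFrames_spec s x _ rfl, h, sectionToFrames_spec t x _ rfl]

/-- A function of `(x, ξ)` as a section of `Λ((E ⊕ … ⊕ E)^*)`. -/
noncomputable def framesToSection (W : Opens (Gr n))
    (f : framesOver W → ExteriorAlgebra ℝ (Fin 2 × Fin m → ℝ)) (L : W) :
    ExteriorAlgebra ℝ (Module.Dual ℝ (Fibre m L.1)) :=
  ExteriorAlgebra.map (pairing L.1 (someFrame L).1) (f (someFrame L))

theorem framesToSection_planeIn {W : Opens (Gr n)}
    {f : framesOver W → ExteriorAlgebra ℝ (Fin 2 × Fin m → ℝ)} (hf : f ∈ superGr n m W)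
    (x : framesOver W) :
    framesToSection W f (planeIn x) = ExteriorAlgebra.map (pairing (planeIn x).1 x.1) (f x) :=
  (superGr_ext hf (planeIn_someFrame (planeIn x)).symm).symm

theorem sectionToFrames_framesToSection {W : Opens (Gr n)}
    {f : framesOver W → ExteriorAlgebra ℝ (Fin 2 × Fin m → ℝ)} (hf : f ∈ superGr n m W) :
    sectionToFrames W (framesToSection W f) = f := by
  ext x
  rw [sectionToFrames_apply, framesToSection_planeIn hf]
  exact map_unpairing_map_pairing ⟨x.1, x.2.fst⟩ _

theorem framesToSection_mem {W : Opens (Gr n)}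
    {f : framesOver W → ExteriorAlgebra ℝ (Fin 2 × Fin m → ℝ)} (hf : f ∈ superGr n m W) :
    framesToSection W f ∈ parityTaut n m W := by
  have h : inFrames W (framesToSection W f) = pullbackHom id (fun x => framePairing x.1) f := by
    ext x
    rw [pullbackHom_apply, ← dualMap_frameMap_pairing ⟨x.1, x.2.fst⟩,
      ← ExteriorAlgebra.map_comp_map, AlgHom.comp_apply]
    exact congrArg _ (framesToSection_planeIn hf x)
  change inFrames W (framesToSection W f) ∈ superFun _ _
  rw [h]
  exact pullbackHom_mem_superFun (ψ := id) contDiff_id.contDiffOn (fun _ => rfl)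
    framePairing_mem_superFun hf.1

/-- The isomorphism of structure sheaves over `W`. -/
noncomputable def bundleEquiv (W : Opens (Gr n)) : parityTaut n m W ≃ₐ[ℝ] superGr n m W :=
  AlgEquiv.ofBijective
    (((sectionToFrames W).comp (parityTaut n m W).val).codRestrict (superGr n m W)
      fun s => sectionToFrames_mem s.2)
    ⟨fun _ _ h => Subtype.ext (sectionToFrames_injective W (congrArg Subtype.val h)),
      fun f => ⟨⟨framesToSection W f.1, framesToSection_mem f.2⟩,
        Subtype.ext (sectionToFrames_framesToSection f.2)⟩⟩

theorem bundleEquiv_apply (W : Opens (Gr n)) (s : parityTaut n m W) (x : framesOver W) :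
    (bundleEquiv W s).1 x =
      ExteriorAlgebra.map (unpairing ⟨x.1, x.2.fst⟩) (s.1 (planeIn x)) := rfl

theorem bundleEquiv_spec (W : Opens (Gr n)) (s : parityTaut n m W) (x : framesOver W) :
    ExteriorAlgebra.map (pairing (planeIn x).1 x.1) ((bundleEquiv W s).1 x) = s.1 (planeIn x) :=
  sectionToFrames_spec s.1 x _ rfl

variable (n m) in
/-- `G_2(V) ≅ Π(E ⊕ … ⊕ E)`. -/
noncomputable def superBundleIso : SuperBundleIso n m where
  toEquiv := bundleEquiv
  restrict := by
    rintro W W' hW s s' h ⟨x, hx⟩ ⟨_, hx'⟩ rfl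
    rw [bundleEquiv_apply, bundleEquiv_apply, h]
    rfl
  base := by
    intro W s f h x
    rw [bundleEquiv_apply, h]
    exact AlgHom.commutes _ _
  degree := by
    intro W s k
    constructor
    · intro h x
      exact map_mem_exteriorPower _ (h (planeIn x))
    · intro h L
      obtain ⟨x, rfl⟩ := planeIn_surjective L
      rw [← bundleEquiv_spec]
      exact map_mem_exteriorPower _ (h x)

theorem pluckerOdd_theta (x : Fin 2 → Fin n → ℝ) (a : Fin n) (μ : Fin m) :
    pluckerOdd x (theta a μ) =
      ExteriorAlgebra.ι ℝ ((1 / 2 : ℝ) • (x 0 a • xi 1 μ - x 1 a • xi 0 μ)) := by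
  rw [pluckerOdd, theta, subst_ι]

/-- Writing v in the frame x reduces both sides to Gram entries, and the numerator becomes half the
Gram determinant times `v^b`. The factor 2 in `pairing` is chosen to make this normalization exact.
-/
theorem pairing_fibreCoord (x : Frame n) (b : Fin n) (μ : Fin m) :
    pairing (planeOf x) x.1 ((∑ c, ∑ d, (wedge x.1).1 c d ^ 2)⁻¹ •
      ∑ a, (wedge x.1).1 a b • ((1 / 2 : ℝ) • (x.1 0 a • xi 1 μ - x.1 1 a • xi 0 μ))) =
    LinearMap.proj b ∘ₗ (planeOf x).1.subtype ∘ₗ LinearMap.proj μ := by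
  refine LinearMap.ext fun v => ?_
  obtain ⟨c, rfl⟩ := frameMap_surjective x v
  change _ = (frameMap x c μ).1 b
  have h1 : ∀ i, ∑ b, x.1 i b * (frameMap x c μ).1 b =
      c μ 0 * gram x.1 i 0 + c μ 1 * gram x.1 i 1 := fun i => by
    simp only [frameMap_apply, gram, Finset.mul_sum, ← Finset.sum_add_distrib]
    exact Finset.sum_congr rfl fun _ _ => by ring
  have h2 : ∀ p q : ℝ, ∑ a, (wedge x.1).1 a b * (1 / 2 * (x.1 0 a * (2 * p) - x.1 1 a * (2 * q))) =
      1 / 2 * ((gram x.1 0 0 * x.1 1 b - x.1 0 b * gram x.1 0 1) * p -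
        (gram x.1 0 1 * x.1 1 b - x.1 0 b * gram x.1 1 1) * q) := fun p q => by
    simp only [gram, Finset.sum_mul, Finset.mul_sum, ← Finset.sum_sub_distrib, wedge_apply]
    exact Finset.sum_congr rfl fun _ _ => by ring
  simp only [map_smul, map_sum, map_sub, LinearMap.smul_apply, LinearMap.sum_apply,
    LinearMap.sub_apply, pairing_xi, smul_eq_mul, h1, h2, sum_wedge_sq]
  have hd := gramDet_ne_zero x.2
  rw [frameMap_apply, gram_comm x.1 1 0]
  rw [inv_mul_eq_iff_eq_mul₀ (div_ne_zero hd two_ne_zero), gramDet]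
  ring

theorem superBundleIso_fibreCoord (W : Opens (Gr n)) (b : Fin n) (μ : Fin m)
    (s : parityTaut n m W) (hs : ∀ L : W, s.1 L = fibreCoord L.1 b μ) (x : framesOver W) :
    ((superBundleIso n m).toEquiv W s).1 x =
      (∑ c, ∑ d, (wedge x.1).1 c d ^ 2)⁻¹ •
        ∑ a, (wedge x.1).1 a b • pluckerOdd x.1 (theta a μ) := by
  change (bundleEquiv W s).1 x = _
  refine Function.LeftInverse.injective (map_unpairing_map_pairing ⟨x.1, x.2.fst⟩) ?_
  refine (bundleEquiv_spec W s x).trans ?_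
  simp only [pluckerOdd_theta, ← map_smul, ← map_sum]
  rw [ExteriorAlgebra.map_apply_ι, pairing_fibreCoord ⟨x.1, x.2.fst⟩, hs]
  rfl

end Iso

/-! ### The underlying Plücker map is a closed embedding. -/

section Plucker

variable {n m : ℕ}

/-- The antisymmetric part of an array. -/
noncomputable def antisymm : (Fin n → Fin n → ℝ) →ₗ[ℝ] Bivector n where
  toFun T := ⟨fun a b => (1 / 2 : ℝ) * (T a b - T b a), fun a b => by ring⟩
  map_add' S T := by
    ext a b
    change (1 / 2 : ℝ) * ((S a b + T a b) - (S b a + T b a)) =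
      (1 / 2 : ℝ) * (S a b - S b a) + (1 / 2 : ℝ) * (T a b - T b a)
    ring
  map_smul' c T := by
    ext a b
    change (1 / 2 : ℝ) * (c * T a b - c * T b a) = c * ((1 / 2 : ℝ) * (T a b - T b a))
    ring

theorem antisymm_coe (T : Bivector n) : antisymm T.1 = T := by
  ext a b
  change (1 / 2 : ℝ) * (T.1 a b - T.1 b a) = T.1 a b
  rw [T.2 b a]
  ring

theorem contDiffOn_bivector {X : Type*} [NormedAddCommGroup X] [NormedSpace ℝ X] {N : Set X}
    {f : X → Bivector n} (h : ∀ a b, ContDiffOn ℝ ∞ (fun x => (f x).1 a b) N) :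
    ContDiffOn ℝ ∞ f N := by
  have h1 : ContDiffOn ℝ ∞ (fun x => (f x).1) N :=
    contDiffOn_pi.2 fun a => contDiffOn_pi.2 fun b => h a b
  have h2 := (LinearMap.toContinuousLinearMap (antisymm (n := n))).contDiff.comp_contDiffOn h1
  exact h2.congr fun x _ => (antisymm_coe (f x)).symm

theorem contDiff_entry (a b : Fin n) : ContDiff ℝ ∞ fun T : Bivector n => T.1 a b :=
  (LinearMap.toContinuousLinearMap
    (LinearMap.proj b ∘ₗ LinearMap.proj (φ := fun _ => Fin n → ℝ) a ∘ₗ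
      (Bivector n).subtype)).contDiff

theorem contDiffOn_wedge (N : Set (Fin 2 → Fin n → ℝ)) : ContDiffOn ℝ ∞ wedge N := by
  refine contDiffOn_bivector fun a b => ContDiff.contDiffOn ?_
  simp only [wedge_apply]
  fun_prop

theorem continuous_wedge : Continuous (wedge (n := n)) := by
  rw [← continuousOn_univ]
  exact (contDiffOn_wedge _).continuousOn

theorem wedge_mk (x : Frame n) : wedge x.1 ≠ 0 := linearIndependent_iff_wedge_ne_zero.1 x.2

theorem evenRelations_wedge (x : Fin 2 → Fin n → ℝ) : EvenRelations (wedge x).1 :=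
  IsWedge.evenRelations (u := x) fun _ _ => rfl

theorem EvenRelations.smul {T : Bivector n} (h : EvenRelations T.1) (c : ℝ) :
    EvenRelations (c • T).1 := by
  intro p q r s
  have := h p q r s
  simp only [evenDefect] at this ⊢
  change c * T.1 p q * (c * T.1 r s) - (c * T.1 p r * (c * T.1 q s) +
    c * T.1 p s * (c * T.1 r q)) = 0
  linear_combination c ^ 2 * this

theorem exists_entry_ne_zero {T : Bivector n} (hT : T ≠ 0) : ∃ a b, T.1 a b ≠ 0 := by
  by_contra! h
  exact hT (Subtype.ext (funext fun a => funext fun b => h a b))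

/-- The rows `a` and `b` of a bivector, a frame of its plane if `T^{ab} ≠ 0`. -/
def rowFrame (a b : Fin n) (T : Bivector n) : Fin 2 → Fin n → ℝ := fun i => T.1 (![a, b] i)

theorem contDiff_rowFrame (a b : Fin n) : ContDiff ℝ ∞ (rowFrame a b) :=
  contDiff_pi.2 fun i => contDiff_pi.2 fun c => contDiff_entry (![a, b] i) c

/-- By antisymmetry the minor of these rows in the columns a and b is the square of `T^{ab}`; no
Plücker relation is needed. -/
theorem linearIndependent_rowFrame {a b : Fin n} {T : Bivector n} (h : T.1 a b ≠ 0) :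
    LinearIndependent ℝ (rowFrame a b T) := by
  rw [linearIndependent_iff_wedge_ne_zero]
  intro h0
  have h1 : (wedge (rowFrame a b T)).1 a b = 0 := by rw [h0]; rfl
  have h2 : (1 / 2 : ℝ) * (T.1 a a * T.1 b b - T.1 a b * T.1 b a) = 0 := h1
  have h3 := T.2 a a
  have h4 := T.2 b a
  refine h (pow_eq_zero_iff two_ne_zero |>.1 ?_)
  rw [h4] at h2
  linear_combination 2 * h2 - (T.1 b b / 2) * h3

theorem wedge_rowFrame {T : Bivector n} (h : EvenRelations T.1) (a b : Fin n) :
    wedge (rowFrame a b T) = (1 / 2 * T.1 a b) • T := by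
  ext c d
  change (1 / 2 : ℝ) * (T.1 a c * T.1 b d - T.1 a d * T.1 b c) = 1 / 2 * T.1 a b * T.1 c d
  have h1 := h a b c d
  rw [evenDefect, T.2 c b] at h1
  linear_combination (-1 / 2) * h1

/-- The matrix that carries a frame to the frame formed by two rows of its bivector. -/
noncomputable def rowMatrix (a b : Fin n) (x : Fin 2 → Fin n → ℝ) : Matrix (Fin 2) (Fin 2) ℝ :=
  Matrix.of fun i => ![-(1 / 2 * x 1 (![a, b] i)), 1 / 2 * x 0 (![a, b] i)]

theorem rowFrame_wedge (a b : Fin n) (x : Fin 2 → Fin n → ℝ) :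
    rowFrame a b (wedge x) = rowAct (rowMatrix a b x) x := by
  ext i c
  rw [rowAct_apply]
  change 1 / 2 * (x 0 (![a, b] i) * x 1 c - x 0 c * x 1 (![a, b] i)) =
    -(1 / 2 * x 1 (![a, b] i)) * x 0 c + 1 / 2 * x 0 (![a, b] i) * x 1 c
  ring

theorem det_rowMatrix (a b : Fin n) (x : Fin 2 → Fin n → ℝ) :
    (rowMatrix a b x).det = 1 / 2 * (wedge x).1 a b := by
  rw [Matrix.det_fin_two, wedge_apply]
  simp [rowMatrix]
  ring

theorem exists_rowFrame_wedge {a b : Fin n} {x : Fin 2 → Fin n → ℝ} (h : (wedge x).1 a b ≠ 0) :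
    ∃ g : GL (Fin 2) ℝ, g.1 = rowMatrix a b x ∧ rowFrame a b (wedge x) = rowAct g.1 x :=
  ⟨Matrix.GeneralLinearGroup.mkOfDetNeZero (rowMatrix a b x)
    (by rw [det_rowMatrix]; exact mul_ne_zero (by norm_num) h), rfl, rowFrame_wedge a b x⟩

/-- A scalar as an element of `GL(2)`. -/
noncomputable def scalarGL (c : ℝ) (hc : c ≠ 0) : GL (Fin 2) ℝ :=
  Matrix.GeneralLinearGroup.mkOfDetNeZero (Matrix.diagonal fun _ => c) (by simp [hc])

theorem rowFrame_smul (a b : Fin n) {c : ℝ} (hc : c ≠ 0) (T : Bivector n) :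
    rowFrame a b (c • T) = rowAct (scalarGL c hc).1 (rowFrame a b T) := by
  ext i d
  rw [rowAct_apply]
  change c * T.1 (![a, b] i) d = Matrix.diagonal (fun _ => c) i 0 * T.1 a d +
    Matrix.diagonal (fun _ => c) i 1 * T.1 b d
  fin_cases i <;> simp

/-- The underlying map of the super Plücker map. -/
noncomputable def plucker (L : Gr n) : ℙ ℝ (Bivector n) :=
  Projectivization.mk ℝ (wedge (planeOf_surjective L).choose.1) (wedge_mk _)

theorem plucker_planeOf (x : Frame n) :
    plucker (planeOf x) = Projectivization.mk ℝ (wedge x.1) (wedge_mk x) := by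
  have h := (planeOf_surjective (planeOf x)).choose_spec
  obtain ⟨g, hg⟩ := exists_rowAct_of_planeOf_eq h
  rw [plucker, Projectivization.mk_eq_mk_iff']
  exact ⟨g.1.det, by rw [hg, wedge_rowAct]⟩

theorem continuous_projMk :
    Continuous fun T : {T : Bivector n // T ≠ 0} => Projectivization.mk ℝ T.1 T.2 :=
  continuous_coinduced_rng

theorem isOpen_proj_iff {U : Set (ℙ ℝ (Bivector n))} :
    IsOpen U ↔ IsOpen {T : Bivector n | ∃ h : T ≠ 0, Projectivization.mk ℝ T h ∈ U} := by
  have h1 : {T : Bivector n | ∃ h : T ≠ 0, Projectivization.mk ℝ T h ∈ U} = Subtype.val ''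
      ((fun T : {T : Bivector n // T ≠ 0} => Projectivization.mk ℝ T.1 T.2) ⁻¹' U) := by
    ext T
    constructor
    · rintro ⟨h, hU⟩
      exact ⟨⟨T, h⟩, hU, rfl⟩
    · rintro ⟨S, hS, rfl⟩
      exact ⟨S.2, hS⟩
  rw [h1, isOpen_coinduced]
  have h2 : IsOpen {T : Bivector n | T ≠ 0} := isOpen_ne
  exact h2.isOpenEmbedding_subtypeVal.isOpen_iff_image_isOpen

theorem isOpen_coneOver (Ω : Opens (ℙ ℝ (Bivector n))) : IsOpen (coneOver Ω) :=
  isOpen_proj_iff.1 Ω.2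

theorem continuous_plucker : Continuous (plucker (n := n)) := by
  refine continuous_coinduced_dom.2 ?_
  have h : plucker (n := n) ∘ planeOf =
      (fun T : {T : Bivector n // T ≠ 0} => Projectivization.mk ℝ T.1 T.2) ∘
        fun x : Frame n => ⟨wedge x.1, wedge_mk x⟩ := by
    ext x
    exact plucker_planeOf x
  rw [h]
  exact continuous_projMk.comp ((continuous_wedge.comp continuous_subtype_val).subtype_mk _)

theorem rowFrame_wedge_mem_framesOver_iff {a b : Fin n} {W : Opens (Gr n)} {x : Fin 2 → Fin n → ℝ}
    (hx : LinearIndependent ℝ x) (h : (wedge x).1 a b ≠ 0) :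
    rowFrame a b (wedge x) ∈ framesOver W ↔ planeOf ⟨x, hx⟩ ∈ W := by
  obtain ⟨g, -, hg⟩ := exists_rowFrame_wedge h
  rw [← planeOf_rowAct g (y := ⟨_, linearIndependent_rowFrame h⟩) hg]
  exact ⟨fun hW => hW.snd, fun hW => ⟨_, hW⟩⟩

/-- The points with `T^{ab} ≠ 0` whose rows `a` and `b` span a plane that belongs to `W`. -/
def rowChart (a b : Fin n) (W : Opens (Gr n)) : Set (ℙ ℝ (Bivector n)) :=
  {p | p.rep.1 a b ≠ 0 ∧ rowFrame a b p.rep ∈ framesOver W}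

/-- Changing the representative multiplies the row frame by a scalar matrix in GL(2), which
preserves its plane. -/
theorem mk_mem_rowChart {a b : Fin n} {W : Opens (Gr n)} {T : Bivector n} (hT : T ≠ 0) :
    Projectivization.mk ℝ T hT ∈ rowChart a b W ↔
      T.1 a b ≠ 0 ∧ rowFrame a b T ∈ framesOver W := by
  obtain ⟨c, hc⟩ := Projectivization.exists_smul_eq_mk_rep ℝ T hT
  have hc' : (Projectivization.mk ℝ T hT).rep = (c : ℝ) • T := hc.symm
  have hc0 : (c : ℝ) ≠ 0 := c.ne_zero
  rw [rowChart, Set.mem_ofPred_eq, hc', rowFrame_smul a b hc0]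
  refine and_congr ?_ ⟨fun h => ?_, fun h => rowAct_mem_framesOver _ h⟩
  · change (c : ℝ) * T.1 a b ≠ 0 ↔ _
    simp [hc0]
  · have := rowAct_mem_framesOver (scalarGL (c : ℝ)⁻¹ (inv_ne_zero hc0)) h
    rwa [← rowFrame_smul, ← rowFrame_smul, smul_smul, inv_mul_cancel₀ hc0, one_smul] at this

theorem isOpen_rowChart (a b : Fin n) (W : Opens (Gr n)) : IsOpen (rowChart a b W) := by
  rw [isOpen_proj_iff]
  have h : {T : Bivector n | ∃ h : T ≠ 0, Projectivization.mk ℝ T h ∈ rowChart a b W} =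
      {T | T.1 a b ≠ 0} ∩ rowFrame a b ⁻¹' framesOver W := by
    ext T
    constructor
    · rintro ⟨hT, h⟩
      exact (mk_mem_rowChart hT).1 h
    · intro h
      have hT : T ≠ 0 := by
        rintro rfl
        exact h.1 rfl
      exact ⟨hT, (mk_mem_rowChart hT).2 h⟩
  rw [h]
  exact (isOpen_ne.preimage (contDiff_entry a b).continuous).inter
    ((isOpen_framesOver W).preimage (contDiff_rowFrame a b).continuous)

theorem plucker_mem_rowChart {a b : Fin n} {W : Opens (Gr n)} (x : Frame n) :
    plucker (planeOf x) ∈ rowChart a b W ↔ (wedge x.1).1 a b ≠ 0 ∧ planeOf x ∈ W := by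
  rw [plucker_planeOf, mk_mem_rowChart]
  exact and_congr_right fun h => rowFrame_wedge_mem_framesOver_iff x.2 h

/-- The plane is recovered as the span of two rows of its bivector, and proportional bivectors have
the same row spans. -/
theorem plucker_injective : Function.Injective (plucker (n := n)) := by
  intro L L' h
  obtain ⟨x, rfl⟩ := planeOf_surjective L
  obtain ⟨y, rfl⟩ := planeOf_surjective L'
  rw [plucker_planeOf, plucker_planeOf, Projectivization.mk_eq_mk_iff'] at h
  obtain ⟨c, hc⟩ := h
  have hc0 : c ≠ 0 := fun h0 => wedge_mk x (by rw [← hc, h0, zero_smul])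
  obtain ⟨a, b, hab⟩ := exists_entry_ne_zero (wedge_mk y)
  have hab' : (wedge x.1).1 a b ≠ 0 := by
    rw [← hc]
    exact mul_ne_zero hc0 hab
  obtain ⟨g, -, hg⟩ := exists_rowFrame_wedge hab
  obtain ⟨g', -, hg'⟩ := exists_rowFrame_wedge hab'
  rw [← planeOf_rowAct g (x := y) (y := ⟨_, linearIndependent_rowFrame hab⟩) hg,
    ← planeOf_rowAct g' (x := x) (y := ⟨_, linearIndependent_rowFrame hab'⟩) hg']
  exact planeOf_rowAct (scalarGL c hc0) (by rw [← rowFrame_smul, hc])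

theorem range_plucker :
    Set.range (plucker (n := n)) = {p | EvenRelations (p.rep : Fin n → Fin n → ℝ)} := by
  ext p
  constructor
  · rintro ⟨L, rfl⟩
    obtain ⟨x, rfl⟩ := planeOf_surjective L
    rw [plucker_planeOf]
    obtain ⟨c, hc⟩ := Projectivization.exists_smul_eq_mk_rep ℝ _ (wedge_mk x)
    rw [Set.mem_ofPred_eq, ← hc]
    exact (evenRelations_wedge x.1).smul (c : ℝ)
  · intro h
    obtain ⟨a, b, hab⟩ := exists_entry_ne_zero p.rep_nonzero
    refine ⟨planeOf ⟨_, linearIndependent_rowFrame hab⟩, ?_⟩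
    rw [plucker_planeOf]
    conv_rhs => rw [← p.mk_rep]
    rw [Projectivization.mk_eq_mk_iff']
    exact ⟨_, (wedge_rowFrame h a b).symm⟩

theorem isClosed_range_plucker : IsClosed (Set.range (plucker (n := n))) := by
  rw [← isOpen_compl_iff, isOpen_proj_iff, range_plucker]
  have h : {T : Bivector n | ∃ h : T ≠ 0, Projectivization.mk ℝ T h ∈
      {p : ℙ ℝ (Bivector n) | EvenRelations (p.rep : Fin n → Fin n → ℝ)}ᶜ} =
      -- The zero bivector satisfies every relation, so the condition `T ≠ 0` is automatic on the
      -- right.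
      ⋃ a, ⋃ b, ⋃ c, ⋃ d, {T : Bivector n | evenDefect T.1 a b c d ≠ 0} := by
    ext T
    simp only [Set.mem_iUnion, Set.mem_ofPred_eq, Set.mem_compl_iff]
    have h1 : (∃ a b c d, evenDefect T.1 a b c d ≠ 0) ↔ ¬ EvenRelations T.1 := by
      simp [EvenRelations]
    rw [h1]
    constructor
    · rintro ⟨hT, h⟩ h'
      obtain ⟨c, hc⟩ := Projectivization.exists_smul_eq_mk_rep ℝ T hT
      refine h ?_
      rw [← hc]
      exact h'.smul (c : ℝ)
    · intro h
      have hT : T ≠ 0 := by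
        rintro rfl
        exact h fun a b c d => by simp [evenDefect]
      refine ⟨hT, fun h' => h ?_⟩
      obtain ⟨c, hc⟩ := Projectivization.exists_smul_eq_mk_rep ℝ T hT
      have hc' : T = (c : ℝ)⁻¹ • (Projectivization.mk ℝ T hT).rep := by
        rw [← hc]
        exact (inv_smul_smul₀ c.ne_zero T).symm
      rw [hc']
      exact EvenRelations.smul h' _
  rw [h]
  refine isOpen_iUnion fun a => isOpen_iUnion fun b => isOpen_iUnion fun c =>
    isOpen_iUnion fun d => isOpen_ne.preimage ?_
  have := fun a b => (contDiff_entry (n := n) a b).continuous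
  exact ((this a b).mul (this c d)).sub
    (((this a c).mul (this b d)).add ((this a d).mul (this c b)))

/-- An open W is the preimage of the union of its row charts, because every bivector of a frame has
a nonzero entry. -/
theorem isClosedEmbedding_plucker : Topology.IsClosedEmbedding (plucker (n := n)) := by
  refine ⟨⟨⟨le_antisymm continuous_plucker.le_induced fun W hW => ?_⟩, plucker_injective⟩,
    isClosed_range_plucker⟩
  refine ⟨⋃ a, ⋃ b, rowChart a b ⟨W, hW⟩,
    isOpen_iUnion fun a => isOpen_iUnion fun b => isOpen_rowChart a b _, ?_⟩
  ext L
  obtain ⟨x, rfl⟩ := planeOf_surjective L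
  simp only [Set.mem_preimage, Set.mem_iUnion, plucker_mem_rowChart]
  constructor
  · rintro ⟨a, b, -, h⟩
    exact h
  · intro h
    obtain ⟨a, b, hab⟩ := exists_entry_ne_zero (wedge_mk x)
    exact ⟨a, b, hab, h⟩

end Plucker

/-! ### Pullback of superfunctions and local surjectivity. -/

section Pullback

variable {n m : ℕ}

/-- The image of `θ^{aμ}` under the super Plücker map, as a linear form in `ξ`. -/
noncomputable def thetaImage (x : Fin 2 → Fin n → ℝ) (p : Fin n × Fin m) : Fin 2 × Fin m → ℝ :=
  (1 / 2 : ℝ) • (x 0 p.1 • xi 1 p.2 - x 1 p.1 • xi 0 p.2)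

theorem pluckerOdd_eq_subst (x : Fin 2 → Fin n → ℝ) :
    pluckerOdd (m := m) x = subst (thetaImage x) := rfl

theorem linearCombination_xi {M : Type*} [AddCommGroup M] [Module ℝ M] (w : Fin 2 × Fin m → M)
    (i : Fin 2) (μ : Fin m) : Fintype.linearCombination ℝ w (xi i μ) = w (i, μ) := by
  rw [xi, Fintype.linearCombination_apply_single, one_smul]

theorem wedge_mem_coneOver {Ω : Opens (ℙ ℝ (Bivector n))} {W : Opens (Gr n)}
    (h : (W : Set (Gr n)) = plucker ⁻¹' Ω) (x : framesOver W) : wedge x.1 ∈ coneOver Ω := by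
  refine ⟨wedge_mk ⟨x.1, x.2.fst⟩, ?_⟩
  rw [← plucker_planeOf ⟨x.1, x.2.fst⟩]
  have hx : planeOf ⟨x.1, x.2.fst⟩ ∈ (W : Set (Gr n)) := x.2.snd
  rw [h] at hx
  exact hx

/-- Under g the coordinates θ scale by det g, just as T does, so homogeneous functions pull back to
GL(2)-invariant ones. -/
theorem subst_thetaImage_rowAct (g : Matrix (Fin 2) (Fin 2) ℝ) (x : Fin 2 → Fin n → ℝ)
    (y : ExteriorAlgebra ℝ (Fin n × Fin m → ℝ)) :
    subst (fun p : Fin 2 × Fin m => ∑ j, g p.1 j • xi j p.2) (pluckerOdd (rowAct g x) y) =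
      pluckerOdd x (subst
        (fun p : Fin n × Fin m => g.det • (Pi.single p 1 : Fin n × Fin m → ℝ)) y) := by
  rw [pluckerOdd_eq_subst, pluckerOdd_eq_subst, subst_subst, subst_subst]
  congr 2
  ext1 p
  simp only [thetaImage, map_smul, map_sub, linearCombination_xi,
    Fintype.linearCombination_apply_single, one_smul, Fin.sum_univ_two, rowAct_apply,
    Matrix.det_fin_two]
  module

/-- The pullback of functions under the super Plücker map. -/
noncomputable def pluckerPullback {Ω : Opens (ℙ ℝ (Bivector n))} {W : Opens (Gr n)}
    (h : (W : Set (Gr n)) = plucker ⁻¹' Ω) :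
    (coneOver Ω → ExteriorAlgebra ℝ (Fin n × Fin m → ℝ)) →ₐ[ℝ]
      (framesOver W → ExteriorAlgebra ℝ (Fin 2 × Fin m → ℝ)) :=
  pullbackHom (fun x => ⟨wedge x.1, wedge_mem_coneOver h x⟩)
    fun x => Fintype.linearCombination ℝ (thetaImage x.1)

theorem pluckerPullback_apply {Ω : Opens (ℙ ℝ (Bivector n))} {W : Opens (Gr n)}
    (h : (W : Set (Gr n)) = plucker ⁻¹' Ω)
    (f : coneOver Ω → ExteriorAlgebra ℝ (Fin n × Fin m → ℝ)) (x : framesOver W) :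
    pluckerPullback h f x = pluckerOdd x.1 (f ⟨wedge x.1, wedge_mem_coneOver h x⟩) := rfl

theorem thetaImage_mem_superFun {N : Set (Fin 2 → Fin n → ℝ)} (p : Fin n × Fin m) :
    (fun x : N => ExteriorAlgebra.ι ℝ (thetaImage x.1 p)) ∈ superFun N _ := by
  have h : ∀ x : Fin 2 → Fin n → ℝ, thetaImage x p =
      (1 / 2 * x 0 p.1) • xi 1 p.2 + (-(1 / 2) * x 1 p.1) • xi 0 p.2 := fun x => by
    rw [thetaImage]; module
  simp only [h]
  exact ι_add_mem_superFun
    (smul_ι_mem_superFun (ContDiff.contDiffOn (f := fun x : Fin 2 → Fin n → ℝ => 1 / 2 * x 0 p.1)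
      (by fun_prop)) _)
    (smul_ι_mem_superFun
      (ContDiff.contDiffOn (f := fun x : Fin 2 → Fin n → ℝ => -(1 / 2) * x 1 p.1)
      (by fun_prop)) _)

theorem pluckerPullback_mem {Ω : Opens (ℙ ℝ (Bivector n))} {W : Opens (Gr n)}
    (h : (W : Set (Gr n)) = plucker ⁻¹' Ω)
    {f : coneOver Ω → ExteriorAlgebra ℝ (Fin n × Fin m → ℝ)} (hf : f ∈ projFun n m Ω) :
    pluckerPullback h f ∈ superGr n m W := by
  refine ⟨pullbackHom_mem_superFun (contDiffOn_wedge _) (fun _ => rfl)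
    (linearCombination_mem_superFun thetaImage_mem_superFun) hf.1, ?_⟩
  rintro g x ⟨_, hy⟩ rfl
  rw [pluckerPullback_apply, pluckerPullback_apply, subst_thetaImage_rowAct]
  exact congrArg _ (hf.2 _ _ _ (Matrix.GeneralLinearGroup.det_ne_zero g) (wedge_rowAct _ _))

theorem isPluckerPullback {Ω : Opens (ℙ ℝ (Bivector n))} {W : Opens (Gr n)}
    (h : (W : Set (Gr n)) = plucker ⁻¹' Ω) (f : projFun n m Ω) :
    IsPluckerPullback f
      (⟨pluckerPullback h f.1, pluckerPullback_mem h f.2⟩ : superGr n m W) := by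
  rintro x ⟨_, hT⟩ rfl
  rfl

/-- The linear odd coordinates `θ^{aμ}`, `θ^{bμ}`. -/
def rowTheta (a b : Fin n) (p : Fin 2 × Fin m) : Fin n × Fin m → ℝ :=
  Pi.single (![a, b] p.1, p.2) 1

theorem rowFrame_mem_framesOver {a b : Fin n} {W : Opens (Gr n)}
    (T : coneOver ⟨rowChart a b W, isOpen_rowChart a b W⟩) :
    rowFrame a b T.1 ∈ framesOver W :=
  ((mk_mem_rowChart T.2.fst).1 T.2.snd).2

/-- The pullback of functions under `(T, θ) ↦ (T^{a·}, T^{b·}, θ^{a·}, θ^{b·})`. -/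
noncomputable def rowPullback (a b : Fin n) (W : Opens (Gr n)) :
    (framesOver W → ExteriorAlgebra ℝ (Fin 2 × Fin m → ℝ)) →ₐ[ℝ]
      (coneOver ⟨rowChart a b W, isOpen_rowChart a b W⟩ → ExteriorAlgebra ℝ (Fin n × Fin m → ℝ)) :=
  pullbackHom (fun T => ⟨rowFrame a b T.1, rowFrame_mem_framesOver T⟩)
    fun _ => Fintype.linearCombination ℝ (rowTheta a b)

theorem rowPullback_mem_superFun (a b : Fin n) {W : Opens (Gr n)}
    {s : framesOver W → ExteriorAlgebra ℝ (Fin 2 × Fin m → ℝ)} (hs : s ∈ superFun _ _) :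
    rowPullback a b W s ∈ superFun _ _ :=
  pullbackHom_mem_superFun (ψ := rowFrame a b) (contDiff_rowFrame a b).contDiffOn (fun _ => rfl)
    (fun v => ι_mem_superFun (Fintype.linearCombination ℝ (rowTheta a b) v)) hs

/-- Evaluate `s` on the rows a and b of (T, θ). Scaling (T, θ) acts on the rows through scalars in
GL(2), so the result is homogeneous of degree 0. -/
theorem exists_isPluckerPullback {W : Opens (Gr n)} (s : superGr n m W) (a b : Fin n) :
    ∃ f : projFun n m ⟨rowChart a b W, isOpen_rowChart a b W⟩, IsPluckerPullback f s := by
  refine ⟨⟨rowPullback a b W s.1, rowPullback_mem_superFun a b s.2.1, ?_⟩, ?_⟩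
  · rintro c ⟨_, hS⟩ T hc rfl
    have h := s.2.2 (scalarGL c hc) ⟨rowFrame a b T.1, rowFrame_mem_framesOver T⟩
        ⟨rowFrame a b (c • T.1), rowFrame_mem_framesOver ⟨_, hS⟩⟩ (rowFrame_smul a b hc _)
    change subst _ (subst (rowTheta a b) (s.1 ⟨rowFrame a b (c • T.1), _⟩)) =
      subst (rowTheta a b) (s.1 ⟨rowFrame a b T.1, _⟩)
    rw [← h, subst_subst, subst_subst]
    congr 2
    ext1 p
    simp only [rowTheta, Fintype.linearCombination_apply_single, one_smul, Fin.sum_univ_two]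
    obtain ⟨i, μ⟩ := p
    fin_cases i <;>
      simp [scalarGL, Matrix.GeneralLinearGroup.mkOfDetNeZero, linearCombination_xi, rowTheta]
  · rintro x ⟨_, hT⟩ rfl
    -- At a Plücker point the even and odd rows are obtained from x and ξ by one and the same g, so
    -- invariance of `s` returns its value at (x, ξ).
    obtain ⟨g, hg, hgx⟩ := exists_rowFrame_wedge ((mk_mem_rowChart hT.fst).1 hT.snd).1
    rw [← s.2.2 g x ⟨rowFrame a b (wedge x.1), rowFrame_mem_framesOver ⟨_, hT⟩⟩ hgx]
    change _ = pluckerOdd x.1 (subst (rowTheta a b) _)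
    rw [pluckerOdd_eq_subst, subst_subst]
    congr 2
    ext1 p
    simp only [rowTheta, Fintype.linearCombination_apply_single, one_smul, Fin.sum_univ_two, hg,
      thetaImage, rowMatrix, Matrix.of_apply, Matrix.cons_val_zero, Matrix.cons_val_one]
    module

end Pullback

/-! ### The kernel of the pullback is generated by the relations. -/

section Kernel

variable {n m : ℕ} {N : Set (Bivector n)}

theorem algebraMap_evenDefect {M : Type*} [AddCommGroup M] [Module ℝ M] (T : Fin n → Fin n → ℝ)
    (a b c d : Fin n) :
    evenDefect (fun p q => algebraMap ℝ (ExteriorAlgebra ℝ M) (T p q)) a b c d =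
      algebraMap ℝ _ (evenDefect T a b c d) := by
  simp only [evenDefect, map_sub, map_add, map_mul]

theorem oddDefect_theta (T : Fin n → Fin n → ℝ) (a b c : Fin n) (μ : Fin m) :
    oddDefect (fun p q => algebraMap ℝ (ExteriorAlgebra ℝ (Fin n × Fin m → ℝ)) (T p q))
      (fun p => theta p μ) a b c =
    ExteriorAlgebra.ι ℝ (T a b • Pi.single (c, μ) 1 -
      (T a c • Pi.single (b, μ) 1 + T c b • Pi.single (a, μ) 1)) := by
  simp only [oddDefect, theta, map_sub, map_add, map_smul, ← Algebra.smul_def]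

theorem contDiff_evenDefect (a b c d : Fin n) :
    ContDiff ℝ ∞ fun T : Bivector n => evenDefect T.1 a b c d := by
  have := contDiff_entry (n := n)
  exact ((this a b).mul (this c d)).sub
    (((this a c).mul (this b d)).add ((this a d).mul (this c b)))

/-- A smooth function as a superfunction. -/
noncomputable def smoothElt (m : ℕ) (g : Bivector n → ℝ) (hg : ContDiffOn ℝ ∞ g N) :
    superFun N (Fin n × Fin m → ℝ) :=
  ⟨_, algebraMap_mem_superFun hg⟩

/-- The left-hand side minus the right-hand side of an even relation. -/
noncomputable def evenElt (m : ℕ) (N : Set (Bivector n)) (a b c d : Fin n) :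
    superFun N (Fin n × Fin m → ℝ) :=
  smoothElt m (fun T => evenDefect T.1 a b c d) (contDiff_evenDefect a b c d).contDiffOn

theorem evenElt_mem (a b c d : Fin n) :
    evenElt m N a b c d ∈ Ideal.span (reducedRelations n m N) :=
  Ideal.subset_span (Or.inl ⟨a, b, c, d, fun T => (algebraMap_evenDefect T.1.1 a b c d).symm⟩)

theorem oddDefect_mem_superFun (a b c : Fin n) (μ : Fin m) :
    (fun T : N => oddDefect
      (fun p q => algebraMap ℝ (ExteriorAlgebra ℝ (Fin n × Fin m → ℝ)) (T.1.1 p q))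
      (fun p => theta p μ) a b c) ∈ superFun N _ := by
  have h := fun p q r => mul_mem (algebraMap_mem_superFun (N := N) (M := Fin n × Fin m → ℝ)
    (contDiff_entry p q).contDiffOn) (ι_mem_superFun (N := N) (Pi.single (r, μ) (1 : ℝ)))
  exact sub_mem (h a b c) (add_mem (h a c b) (h c b a))

/-- The left-hand side minus the right-hand side of an odd relation. -/
noncomputable def oddElt (N : Set (Bivector n)) (a b c : Fin n) (μ : Fin m) :
    superFun N (Fin n × Fin m → ℝ) :=
  ⟨_, oddDefect_mem_superFun a b c μ⟩

theorem oddElt_mem (a b c : Fin n) (μ : Fin m) :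
    oddElt N a b c μ ∈ Ideal.span (reducedRelations n m N) :=
  Ideal.subset_span (Or.inr ⟨a, b, c, μ, fun _ => rfl⟩)

theorem pluckerOdd_eq_zero_of_mem {r : superFun N (Fin n × Fin m → ℝ)}
    (hr : r ∈ Ideal.span (reducedRelations n m N)) (x : Fin 2 → Fin n → ℝ) (hx : wedge x ∈ N) :
    pluckerOdd x (r.1 ⟨wedge x, hx⟩) = 0 := by
  let F : superFun N (Fin n × Fin m → ℝ) →ₐ[ℝ] ExteriorAlgebra ℝ (Fin 2 × Fin m → ℝ) :=
    ((pluckerOdd x).comp (Pi.evalAlgHom ℝ _ ⟨wedge x, hx⟩)).comp (Subalgebra.val _)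
  suffices Ideal.span (reducedRelations n m N) ≤ RingHom.ker F from this hr
  refine Ideal.span_le.2 ?_
  rintro r (⟨a, b, c, d, h⟩ | ⟨a, b, c, μ, h⟩)
  · change pluckerOdd x (r.1 ⟨wedge x, hx⟩) = 0
    rw [h, algebraMap_evenDefect, evenRelations_wedge x a b c d, map_zero, map_zero]
  · change pluckerOdd x (r.1 ⟨wedge x, hx⟩) = 0
    rw [h, oddDefect_theta, pluckerOdd_eq_subst, subst, ExteriorAlgebra.map_apply_ι]
    simp only [map_sub, map_add, map_smul, Fintype.linearCombination_apply_single, one_smul]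
    rw [← map_smul, ← map_smul, ← map_smul, ← map_add, ← map_sub,
      oddRelations_of_mem_span (T := (wedge x).1) (u := x)
        (θ := fun a => thetaImage x (a, μ)) (fun _ _ => rfl)
        (α := (1 / 2 : ℝ) • xi 1 μ) (β := (-(1 / 2) : ℝ) • xi 0 μ)
        (fun a => by rw [thetaImage]; module), map_zero]

/-- `Ideal.span` yields a left ideal. It also absorbs odd generators on the right since these
commute with the even relations and anticommute with the odd ones. -/
theorem mul_ι_mem_span {r h : superFun N (Fin n × Fin m → ℝ)} {v : Fin n × Fin m → ℝ}
    (hr : r ∈ Ideal.span (reducedRelations n m N))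
    (hh : ∀ T : N, h.1 T = ExteriorAlgebra.ι ℝ v) :
    r * h ∈ Ideal.span (reducedRelations n m N) := by
  induction hr using Submodule.span_induction with
  | mem r hr =>
    have hmem : r ∈ Ideal.span (reducedRelations n m N) := Ideal.subset_span hr
    rcases hr with ⟨a, b, c, d, hr⟩ | ⟨a, b, c, μ, hr⟩
    · have : r * h = h * r := by
        ext T
        change r.1 T * h.1 T = h.1 T * r.1 T
        rw [hr, algebraMap_evenDefect, Algebra.commutes]
      rw [this]
      exact Ideal.mul_mem_left _ _ hmem
    · have : r * h = -h * r := by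
        ext T
        change r.1 T * h.1 T = -h.1 T * r.1 T
        rw [hr, hh, oddDefect_theta, neg_mul]
        exact eq_neg_of_add_eq_zero_left (ExteriorAlgebra.ι_add_mul_swap _ _)
      rw [this]
      exact Ideal.mul_mem_left _ _ hmem
  | zero => rw [zero_mul]; exact zero_mem _
  | add x y _ _ hx hy => rw [add_mul]; exact add_mem hx hy
  | smul a x _ hx => rw [smul_eq_mul, mul_assoc]; exact Ideal.mul_mem_left _ _ hx

theorem mul_mem_span {r : superFun N (Fin n × Fin m → ℝ)}
    (hr : r ∈ Ideal.span (reducedRelations n m N)) (h : superFun N (Fin n × Fin m → ℝ)) :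
    r * h ∈ Ideal.span (reducedRelations n m N) := by
  obtain ⟨h, hh⟩ := h
  have hcomm : ∀ (h : superFun N (Fin n × Fin m → ℝ)) (g : Bivector n → ℝ),
      (∀ T : N, h.1 T = algebraMap ℝ _ (g T)) → ∀ r, r * h = h * r := fun h g hg r => by
    ext T
    change r.1 T * h.1 T = h.1 T * r.1 T
    rw [hg, Algebra.commutes]
  induction hh using Algebra.adjoin_induction generalizing r with
  | mem h hm =>
    rcases hm with ⟨g, -, hg⟩ | ⟨v, hv⟩
    · rw [hcomm _ g hg]
      exact Ideal.mul_mem_left _ _ hr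
    · exact mul_ι_mem_span hr hv
  | algebraMap c =>
    rw [hcomm _ (fun _ => c) fun _ => rfl]
    exact Ideal.mul_mem_left _ _ hr
  | add x y hx hy ihx ihy =>
    have := add_mem (ihx hr) (ihy hr)
    rwa [← mul_add] at this
  | mul x y hx hy ihx ihy =>
    have := ihy (ihx hr)
    rwa [mul_assoc] at this

/-- A frame of the bivector with the same rows `a` and `b` as `T` that satisfies the even
relations. -/
noncomputable def normalFrame (a b : Fin n) (T : Bivector n) : Fin 2 → Fin n → ℝ :=
  ![T.1 a, (2 * (T.1 a b)⁻¹) • T.1 b]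

/-- The retraction onto the solutions of the even relations, where `T^{ab} ≠ 0`. -/
noncomputable def retract (a b : Fin n) (T : Bivector n) : Bivector n := wedge (normalFrame a b T)

/-- The retraction onto the solutions of the odd relations. -/
noncomputable def oddRetract (a b : Fin n) (T : Bivector n) (p : Fin n × Fin m) :
    Fin n × Fin m → ℝ :=
  (T.1 a b)⁻¹ • (T.1 a p.1 • Pi.single (b, p.2) 1 - T.1 b p.1 • Pi.single (a, p.2) 1)

/-- The odd coordinates that accompany `normalFrame`. -/
noncomputable def normalXi (a b : Fin n) (T : Bivector n) (p : Fin 2 × Fin m) :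
    Fin n × Fin m → ℝ :=
  ![Pi.single (a, p.2) 1, (2 * (T.1 a b)⁻¹) • Pi.single (b, p.2) 1] p.1

theorem retract_apply (a b : Fin n) (T : Bivector n) (c d : Fin n) :
    (retract a b T).1 c d = (T.1 a b)⁻¹ * (T.1 a c * T.1 b d - T.1 a d * T.1 b c) := by
  change (1 / 2 : ℝ) * (T.1 a c * (2 * (T.1 a b)⁻¹ * T.1 b d) -
    T.1 a d * (2 * (T.1 a b)⁻¹ * T.1 b c)) = _
  ring

/-- The displacement of the retraction is a multiple of the relations, so Hadamard's lemma along it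
produces elements of the ideal. -/
theorem sub_retract_apply {a b : Fin n} {T : Bivector n} (h : T.1 a b ≠ 0) (c d : Fin n) :
    (T - retract a b T).1 c d = (T.1 a b)⁻¹ * evenDefect T.1 a b c d := by
  change T.1 c d - (retract a b T).1 c d = _
  rw [retract_apply, evenDefect, T.2 c b]
  field_simp
  ring

theorem retract_eq_self {a b : Fin n} {T : Bivector n} (h : T.1 a b ≠ 0)
    (hT : EvenRelations T.1) : retract a b T = T := by
  refine (sub_eq_zero.1 (Subtype.ext ?_)).symm
  ext c d
  rw [sub_retract_apply h, hT, mul_zero]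
  rfl

theorem sub_oddRetract {a b : Fin n} {T : Bivector n} (h : T.1 a b ≠ 0) (c : Fin n) (μ : Fin m) :
    ExteriorAlgebra.ι ℝ (Pi.single (c, μ) 1 - oddRetract a b T (c, μ)) = (T.1 a b)⁻¹ •
      oddDefect (fun p q => algebraMap ℝ (ExteriorAlgebra ℝ (Fin n × Fin m → ℝ)) (T.1 p q))
        (fun p => theta p μ) a b c := by
  rw [oddDefect_theta, ← map_smul, T.2 c b]
  congr 1
  have e : (Pi.single (c, μ) 1 : Fin n × Fin m → ℝ) =
      ((T.1 a b)⁻¹ * T.1 a b) • Pi.single (c, μ) 1 := by rw [inv_mul_cancel₀ h, one_smul]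
  rw [oddRetract]
  conv_lhs => lhs; rw [e]
  module

theorem contDiffOn_retract {a b : Fin n} (hN : ∀ T ∈ N, T.1 a b ≠ 0) :
    ContDiffOn ℝ ∞ (retract a b) N := by
  refine contDiffOn_bivector fun c d => ?_
  simp only [retract_apply]
  have := fun p q => (contDiff_entry (n := n) p q).contDiffOn (s := N)
  exact ((this a b).inv hN).mul (((this a c).mul (this b d)).sub ((this a d).mul (this b c)))

theorem oddRetract_mem_superFun {a b : Fin n} (hN : ∀ T ∈ N, T.1 a b ≠ 0) (p : Fin n × Fin m) :
    (fun T : N => ExteriorAlgebra.ι ℝ (oddRetract a b T.1 p)) ∈ superFun N _ := by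
  have h : ∀ T : Bivector n, oddRetract a b T p =
      ((T.1 a b)⁻¹ * T.1 a p.1) • (Pi.single (b, p.2) 1 : Fin n × Fin m → ℝ) +
      (-((T.1 a b)⁻¹ * T.1 b p.1)) • Pi.single (a, p.2) 1 := fun T => by
    rw [oddRetract]; module
  have := fun p q => (contDiff_entry (n := n) p q).contDiffOn (s := N)
  simp only [h]
  exact ι_add_mem_superFun
    (smul_ι_mem_superFun (g := fun T : Bivector n => (T.1 a b)⁻¹ * T.1 a p.1)
      (((this a b).inv hN).mul (this a p.1)) _)
    (smul_ι_mem_superFun (g := fun T : Bivector n => -((T.1 a b)⁻¹ * T.1 b p.1))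
      (((this a b).inv hN).mul (this b p.1)).neg _)

/-- The retraction is the Plücker map applied to the rescaled rows of (T, θ); hence anything that
the Plücker map kills is killed by the retraction too. -/
theorem subst_oddRetract (a b : Fin n) (T : Bivector n)
    (y : ExteriorAlgebra ℝ (Fin n × Fin m → ℝ)) :
    subst (oddRetract a b T) y = subst (normalXi a b T) (pluckerOdd (normalFrame a b T) y) := by
  rw [pluckerOdd_eq_subst, subst_subst]
  congr 2
  ext1 p
  simp only [thetaImage, map_smul, map_sub, linearCombination_xi]
  simp only [normalXi, normalFrame, oddRetract, Matrix.cons_val_zero, Matrix.cons_val_one,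
    Pi.smul_apply, smul_eq_mul]
  module

theorem restrict_mem_superFun {U : Set (Bivector n)} (hNU : N ⊆ U)
    {f : U → ExteriorAlgebra ℝ (Fin n × Fin m → ℝ)} (hf : f ∈ superFun U _) :
    (fun T : N => f ⟨T.1, hNU T.2⟩) ∈ superFun N (Fin n × Fin m → ℝ) := by
  have := pullbackHom_mem_superFun (φ := fun T : N => (⟨T.1, hNU T.2⟩ : U))
    (v := fun _ => LinearMap.id) (ψ := id) contDiff_id.contDiffOn (fun _ => rfl)
    (fun v => ι_mem_superFun v) hf
  convert this using 1
  ext T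
  rw [pullbackHom_apply, ExteriorAlgebra.map_id, AlgHom.id_apply]

/-- The inclusion f - ρ*f in the ideal is checked on smooth functions and on odd generators, and
passes to sums and products. Both T and ρ(T) must stay in the half ball, where a coefficient agrees
with its global smooth extension. -/
theorem sub_pullback_mem_span {U : Set (Bivector n)} {a b : Fin n} {T₀ : Bivector n} {R : ℝ}
    (hU : IsOpen U) (hR : 0 < R) (hRU : Metric.closedBall T₀ R ⊆ U) (hNU : N ⊆ U)
    (hab : ∀ T ∈ N, T.1 a b ≠ 0) (hN : N ⊆ Metric.ball T₀ (R / 2))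
    (hρ : ∀ T ∈ N, retract a b T ∈ Metric.ball T₀ (R / 2)) (hρU : ∀ T : N, retract a b T.1 ∈ U)
    {f : U → ExteriorAlgebra ℝ (Fin n × Fin m → ℝ)} (hf : f ∈ superFun U _) :
    ∃ r ∈ Ideal.span (reducedRelations n m N), ∀ T : N,
      f ⟨T.1, hNU T.2⟩ - subst (oddRetract a b T.1) (f ⟨retract a b T.1, hρU T⟩) = r.1 T := by
  have hinv : ContDiffOn ℝ ∞ (fun T : Bivector n => (T.1 a b)⁻¹) N :=
    (contDiff_entry a b).contDiffOn.inv hab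
  induction hf using Algebra.adjoin_induction with
  | mem f hm =>
    rcases hm with ⟨g, hg, hfg⟩ | ⟨v, hv⟩
    · obtain ⟨h, hh, hgh⟩ := exists_contDiff_eqOn_ball hU hR hRU hg
      obtain ⟨D, hD, hD'⟩ := exists_contDiff_sub_eq hh
      -- Hadamard coefficients along the antisymmetrized matrix units, a spanning family that allows
      -- summation over all c and d.
      let G : Fin n → Fin n → Bivector n → ℝ := fun c d T =>
        D (T, retract a b T) (antisymm (Pi.single c (Pi.single d 1))) * (T.1 a b)⁻¹
      have hG : ∀ c d, ContDiffOn ℝ ∞ (G c d) N := fun c d =>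
        ((hD.comp_contDiffOn (contDiffOn_id.prodMk (contDiffOn_retract hab))).clm_apply
          contDiffOn_const).mul hinv
      refine ⟨∑ c, ∑ d, smoothElt m (G c d) (hG c d) * evenElt m N a b c d,
        sum_mem fun c _ => sum_mem fun d _ => Ideal.mul_mem_left _ _ (evenElt_mem a b c d),
        fun T => ?_⟩
      have h1 : (T.1 - retract a b T.1) = ∑ c, ∑ d, (T.1 - retract a b T.1).1 c d •
          antisymm (Pi.single c (Pi.single d 1)) := by
        conv_lhs => rw [← antisymm_coe (T.1 - retract a b T.1)]
        simp only [← map_smul, ← map_sum]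
        congr 1
        ext p q
        rw [Finset.sum_apply, Finset.sum_eq_single p, Finset.sum_apply, Finset.sum_apply,
          Finset.sum_eq_single q]
        · simp
        · intro d _ hd
          simp [Pi.single_eq_of_ne hd.symm]
        · simp
        · intro c _ hc
          simp [Pi.single_eq_of_ne hc.symm]
        · simp
      have h2 : g T.1 - g (retract a b T.1) = ∑ c, ∑ d, G c d T.1 * evenDefect T.1.1 a b c d := by
        rw [hgh (hN T.2), hgh (hρ T.1 T.2), hD']
        conv_lhs => rw [h1]
        simp only [map_sum, map_smul, smul_eq_mul, sub_retract_apply (hab T.1 T.2)]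
        exact Finset.sum_congr rfl fun c _ => Finset.sum_congr rfl fun d _ => by
          simp only [G]; ring
      rw [hfg, hfg, AlgHom.commutes, ← map_sub, h2]
      simp [smoothElt, evenElt, Finset.sum_apply]
    · refine ⟨∑ p, smoothElt m (fun T : Bivector n => v p * (T.1 a b)⁻¹)
          (contDiffOn_const.mul hinv) * oddElt N a b p.1 p.2,
        sum_mem fun p _ => Ideal.mul_mem_left _ _ (oddElt_mem a b p.1 p.2), fun T => ?_⟩
      have h1 : v - Fintype.linearCombination ℝ (oddRetract a b T.1) v =
          ∑ p, v p • (Pi.single (p.1, p.2) 1 - oddRetract a b T.1 (p.1, p.2)) := by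
        rw [Fintype.linearCombination_apply]
        simp only [smul_sub, Finset.sum_sub_distrib]
        congr 1
        ext p
        simp [Finset.sum_apply, Pi.single_apply]
      rw [hv, hv, subst, ExteriorAlgebra.map_apply_ι, ← map_sub, h1, map_sum]
      simp only [map_smul, sub_oddRetract (hab T.1 T.2)]
      simp [smoothElt, oddElt, Finset.sum_apply, Algebra.smul_def, mul_assoc]
  | algebraMap c =>
    refine ⟨0, zero_mem _, fun T => ?_⟩
    rw [Pi.algebraMap_apply, Pi.algebraMap_apply, AlgHom.commutes, sub_self]
    rfl
  | add x y _ _ ihx ihy =>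
    obtain ⟨r, hr, hr'⟩ := ihx
    obtain ⟨q, hq, hq'⟩ := ihy
    refine ⟨r + q, add_mem hr hq, fun T => ?_⟩
    change _ = r.1 T + q.1 T
    rw [← hr', ← hq', Pi.add_apply, Pi.add_apply, map_add]
    abel
  | mul x y hx hy ihx ihy =>
    obtain ⟨r, hr, hr'⟩ := ihx
    obtain ⟨q, hq, hq'⟩ := ihy
    have hx' := restrict_mem_superFun hNU hx
    have hy' : (fun T : N => subst (oddRetract a b T.1) (y ⟨retract a b T.1, hρU T⟩)) ∈
        superFun N (Fin n × Fin m → ℝ) :=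
      pullbackHom_mem_superFun (φ := fun T : N => (⟨retract a b T.1, hρU T⟩ : U))
        (contDiffOn_retract hab) (fun _ => rfl)
        (linearCombination_mem_superFun fun p => oddRetract_mem_superFun hab p) hy
    -- Leibniz rule: xy - ρ*x ρ*y = x(y - ρ*y) + (x - ρ*x)ρ*y; the second term needs the ideal to be
    -- two-sided.
    refine ⟨⟨_, hx'⟩ * q + r * ⟨_, hy'⟩,
      add_mem (Ideal.mul_mem_left _ _ hq) (mul_mem_span hr _), fun T => ?_⟩
    change _ = x ⟨T.1, hNU T.2⟩ * q.1 T +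
      r.1 T * subst (oddRetract a b T.1) (y ⟨retract a b T.1, hρU T⟩)
    rw [← hr', ← hq', Pi.mul_apply, Pi.mul_apply, map_mul]
    noncomm_ring

theorem pluckerPullback_eq_zero {Ω : Opens (ℙ ℝ (Bivector n))} {W : Opens (Gr n)}
    (h : (W : Set (Gr n)) = plucker ⁻¹' Ω) {f : projFun n m Ω} (hf : InReducedIdeal f) :
    pluckerPullback h f.1 = 0 := by
  ext x
  obtain ⟨N, hN, -, hx, r, hr, hfr⟩ := hf ⟨wedge x.1, wedge_mem_coneOver h x⟩
  rw [pluckerPullback_apply, hfr ⟨wedge x.1, hx⟩]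
  exact pluckerOdd_eq_zero_of_mem hr x.1 hx

theorem mem_framesOver_of_wedge_mem {Ω : Opens (ℙ ℝ (Bivector n))} {W : Opens (Gr n)}
    (h : (W : Set (Gr n)) = plucker ⁻¹' Ω) {x : Fin 2 → Fin n → ℝ} (hx : wedge x ∈ coneOver Ω) :
    x ∈ framesOver W := by
  have hx' : LinearIndependent ℝ x := linearIndependent_iff_wedge_ne_zero.2 hx.fst
  refine ⟨hx', ?_⟩
  change planeOf ⟨x, hx'⟩ ∈ (W : Set (Gr n))
  rw [h, Set.mem_preimage, plucker_planeOf]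
  exact hx.snd

theorem inReducedIdeal_of_pluckerPullback_eq_zero {Ω : Opens (ℙ ℝ (Bivector n))}
    {W : Opens (Gr n)} (h : (W : Set (Gr n)) = plucker ⁻¹' Ω) {f : projFun n m Ω}
    (hf : pluckerPullback h f.1 = 0) : InReducedIdeal f := by
  rintro ⟨T₀, hT₀⟩
  by_cases hev : EvenRelations T₀.1
  · obtain ⟨a, b, hab⟩ := exists_entry_ne_zero hT₀.fst
    obtain ⟨R, hR, hRU⟩ := Metric.nhds_basis_closedBall.mem_iff.1
      ((isOpen_coneOver Ω).mem_nhds hT₀)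
    have hball : Metric.ball T₀ (R / 2) ⊆ coneOver Ω := fun T hT =>
      hRU (Metric.ball_subset_closedBall (Metric.ball_subset_ball (by linarith) hT))
    have hopen : IsOpen {T : Bivector n | T.1 a b ≠ 0} :=
      isOpen_ne.preimage (contDiff_entry a b).continuous
    -- `T₀` satisfies (ev), hence is fixed by the retraction and belongs to `N`. Points of `N`
    -- retract into the domain of `f`.
    let N : Set (Bivector n) := Metric.ball T₀ (R / 2) ∩
      ({T : Bivector n | T.1 a b ≠ 0} ∩ retract a b ⁻¹' Metric.ball T₀ (R / 2))
    have hNU : N ⊆ coneOver Ω := fun T hT => hball hT.1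
    have hρU : ∀ T : N, retract a b T.1 ∈ coneOver Ω := fun T => hball T.2.2.2
    obtain ⟨r, hr, hr'⟩ := sub_pullback_mem_span (N := N) (isOpen_coneOver Ω) hR hRU hNU
      (fun T hT => hT.2.1) (fun T hT => hT.1) (fun T hT => hT.2.2) hρU f.2.1
    refine ⟨N, hNU, Metric.isOpen_ball.inter ((contDiffOn_retract fun T hT => hT).continuousOn
      |>.isOpen_inter_preimage hopen Metric.isOpen_ball), ⟨Metric.mem_ball_self (by positivity),
        hab, ?_⟩, r, hr, fun T => ?_⟩
    · rw [Set.mem_preimage, retract_eq_self hab hev]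
      exact Metric.mem_ball_self (by positivity)
    · rw [← hr', subst_oddRetract]
      have h0 := congrFun hf ⟨normalFrame a b T.1, mem_framesOver_of_wedge_mem h (hρU T)⟩
      rw [pluckerPullback_apply] at h0
      have h1 : pluckerOdd (normalFrame a b T.1) (f.1 ⟨retract a b T.1, hρU T⟩) = 0 := h0
      rw [h1, map_zero, sub_zero]
  · simp only [EvenRelations, not_forall] at hev
    obtain ⟨a, b, c, d, hd⟩ := hev
    -- On this set the violated relation is invertible, so the ideal contains every superfunction.
    let N : Set (Bivector n) := coneOver Ω ∩ {T | evenDefect T.1 a b c d ≠ 0}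
    have hNU : N ⊆ coneOver Ω := Set.inter_subset_left
    have hinv : ContDiffOn ℝ ∞ (fun T : Bivector n => (evenDefect T.1 a b c d)⁻¹) N :=
      (contDiff_evenDefect a b c d).contDiffOn.inv fun T hT => hT.2
    refine ⟨N, hNU, (isOpen_coneOver Ω).inter
      (isOpen_ne.preimage (contDiff_evenDefect a b c d).continuous), ⟨hT₀, hd⟩,
      ⟨_, restrict_mem_superFun hNU f.2.1⟩ * smoothElt m _ hinv * evenElt m N a b c d,
      Ideal.mul_mem_left _ _ (evenElt_mem a b c d), fun T => ?_⟩
    change _ = f.1 ⟨T.1, hNU T.2⟩ * algebraMap ℝ _ (evenDefect T.1.1 a b c d)⁻¹ *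
      algebraMap ℝ _ (evenDefect T.1.1 a b c d)
    rw [mul_assoc, ← map_mul, inv_mul_cancel₀ T.2.2, map_one, mul_one]

end Kernel

end SuperGrassmann



theorem mainTheorem10 (n m : ℕ) :
    -- The meaning of the relations, for families with values in any commutative superalgebra.
    (∀ (A : Type*) [Ring A] [Algebra ℝ A] (𝒜 : ZMod 2 → Submodule ℝ A) [GradedAlgebra 𝒜],
      IsSupercommutative 𝒜 →
      ∀ T : Fin n → Fin n → A, (∀ a b, T a b ∈ 𝒜 0) → (∀ a b, T a b = -T b a) →
        (∃ a b, IsUnit (T a b)) →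
        (EvenRelations T ↔ ∃ u : Fin 2 → Fin n → A, (∀ i a, u i a ∈ 𝒜 0) ∧ IsWedge u T) ∧
        ∀ u : Fin 2 → Fin n → A, (∀ i a, u i a ∈ 𝒜 0) → IsWedge u T →
          ∀ θ : Fin m → Fin n → A, (∀ μ a, θ μ a ∈ 𝒜 1) →
            ∀ μ, OddRelations T (θ μ) ↔
              ∃ α : Fin 2 → A, (∀ i, α i ∈ 𝒜 1) ∧ ∀ a, θ μ a = α 0 * u 0 a + α 1 * u 1 a) ∧
    -- The super Plücker map identifies `G_2(V)` with the closed sub-supermanifold of the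
    -- projective superspace with homogeneous coordinates `(T : θ)` defined by the relations.
    (∃ φ : Gr n → ℙ ℝ (Bivector n),
      Topology.IsClosedEmbedding φ ∧
      Set.range φ = {p | EvenRelations (p.rep : Fin n → Fin n → ℝ)} ∧
      (∀ x : Frame n, ∃ h : wedge x.1 ≠ 0, φ (planeOf x) = Projectivization.mk ℝ (wedge x.1) h) ∧
      (∀ (Ω : Opens (ℙ ℝ (Bivector n))) (W : Opens (Gr n)),
        (W : Set (Gr n)) = φ ⁻¹' (Ω : Set (ℙ ℝ (Bivector n))) →
        ∀ f : projFun n m Ω, ∃ s : superGr n m W, IsPluckerPullback f s ∧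
          (s = 0 ↔ InReducedIdeal f)) ∧
      (∀ (W : Opens (Gr n)) (s : superGr n m W), ∀ L ∈ W,
        ∃ Ω : Opens (ℙ ℝ (Bivector n)), φ L ∈ Ω ∧ (∀ L', φ L' ∈ Ω → L' ∈ W) ∧
          ∃ f : projFun n m Ω, IsPluckerPullback f s)) ∧
    -- `G_2(V)` is `Π(E ⊕ … ⊕ E)` over the ordinary Grassmannian.
    (∃ e : SuperBundleIso n m, ∀ (W : Opens (Gr n)) (b : Fin n) (μ : Fin m)
      (s : parityTaut n m W), (∀ L : W, s.1 L = fibreCoord L.1 b μ) →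
      ∀ x : framesOver W, (e.toEquiv W s).1 x =
        (∑ c, ∑ d, (wedge x.1).1 c d ^ 2)⁻¹ •
          ∑ a, (wedge x.1).1 a b • pluckerOdd x.1 (theta a μ)) := by
  refine ⟨fun A _ _ 𝒜 _ hA T hT0 hT hunit => relations_iff 𝒜 hA T hT0 hT hunit,
    ⟨plucker, isClosedEmbedding_plucker, range_plucker, fun x => ⟨wedge_mk x, plucker_planeOf x⟩,
      fun Ω W h f => ⟨_, isPluckerPullback h f, ?_⟩, fun W s L hL => ?_⟩,
    superBundleIso n m, superBundleIso_fibreCoord⟩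
  · rw [← Subtype.coe_inj]
    exact ⟨inReducedIdeal_of_pluckerPullback_eq_zero h, pluckerPullback_eq_zero h⟩
  · obtain ⟨x, rfl⟩ := planeOf_surjective L
    obtain ⟨a, b, hab⟩ := exists_entry_ne_zero (wedge_mk x)
    refine ⟨⟨rowChart a b W, isOpen_rowChart a b W⟩, (plucker_mem_rowChart x).2 ⟨hab, hL⟩,
      fun L' hL' => ?_, exists_isPluckerPullback s a b⟩
    obtain ⟨y, rfl⟩ := planeOf_surjective L'
    exact ((plucker_mem_rowChart y).1 hL').2
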